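/- Let $n\ge 0$. A set $M\subset\mathbb{R}^{n+1}$ is a generalised hypersurface if $M=\partial\Omega$ for a bounded open set $\Omega\subset\mathbb{R}^{n+1}$ and there are $\kappa\in[0,1)$ and $\delta,\theta>0$ such that $\mathcal{H}^{n+\kappa}(M)<\infty$ and $\mathcal{H}^{n+\kappa}(M\cap B(p,\gamma))\ge\theta\gamma^{n+\kappa}$ for all $p\in M$ and all $\gamma\in(0,\delta]$ (the lower density bound). Let $M=\partial\Omega$ be a generalised hypersurface with $\mathcal{H}^n(M)<\infty$ and let $\chi$ be the indicator function of $\Omega$. For $\varepsilon\in(0,1)$ let $u$ be the solution of the $\varepsilon$-Allen–Cahn equation $$\partial_t u=\Delta u-\frac{1}{\varepsilon^2}F'(u)\quad\text{on }\mathbb{R}^{n+1}\times(0,\infty),\qquad F(v)=\tfrac12(1-v^2)^2,$$ with initial data $2\chi-1$; that is, $u$ is bounded on $\mathbb{R}^{n+1}\times(0,T]$ for every $T<\infty$, is smooth on $\mathbb{R}^{n+1}\times(0,\infty)$, satisfies the equation there, and $u(\cdot,t)\to 2\chi-1$ in the sense of distributions as $t\downarrow0$. Write $$E_\varepsilon(t)=\int_{\mathbb{R}^{n+1}}\frac{\varepsilon|Du(x,t)|^2}{2}+\frac{(u(x,t)^2-1)^2}{2\varepsilon}\,dx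 .$$ Then there is a constant $C<\infty$, depending only on $n$, on (an upper bound for) $\mathcal{H}^n(M)$ and on $\delta,\theta$, such that for all $\varepsilon\in(0,1)$ and $t\in(0,\varepsilon^2)$ $$E_\varepsilon(t)\le C\left(\frac{\varepsilon}{\sqrt t}+\frac{\sqrt t}{\varepsilon}\right).$$ Consequently, with the same $C$, for every $\varepsilon\in(0,1)$ one has $E_\varepsilon(t)\le \dfrac{2C}{\sqrt t}$ for $t\in(0,\varepsilon^2)$ and $E_\varepsilon(t)\le 2C$ for all $t\ge\varepsilon^2$. In particular $E_\varepsilon(t)\le 2C/\sqrt t$ for all $t\in(0,1]$, uniformly in $\varepsilon\in(0,1)$. -/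

import Mathlib

open MeasureTheory Set Filter Topology
open scoped ContDiff ENNReal NNReal

noncomputable section

/-- Lower density bound in dimension `s` at all scales up to `δ`, with constant `θ`:
`ℋ^s(M ∩ B(p, γ)) ≥ θ γ^s` for all `p ∈ M` and `γ ∈ (0, δ]`. -/
def HasLowerDensityBound {n : ℕ} (s δ θ : ℝ) (M : Set (EuclideanSpace ℝ (Fin (n + 1)))) : Prop :=
  ∀ p ∈ M, ∀ γ ∈ Ioc (0 : ℝ) δ,
    ENNReal.ofReal (θ * γ ^ s) ≤ μH[s] (M ∩ Metric.ball p γ)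

/-- `M ⊂ ℝ^{n+1}` is a generalised hypersurface, with exponent `n + κ` and lower density
bound `(δ, θ)`, bounding the bounded open set `Ω`. -/
structure IsGeneralisedHypersurface (n : ℕ) (κ δ θ : ℝ)
    (Ω M : Set (EuclideanSpace ℝ (Fin (n + 1)))) : Prop where
  isOpen : IsOpen Ω
  isBounded : Bornology.IsBounded Ω
  eq_frontier : M = frontier Ω
  exponent_mem : κ ∈ Ico (0 : ℝ) 1
  hausdorff_lt_top : μH[(n : ℝ) + κ] M < ⊤
  scale_pos : 0 < δ
  density_pos : 0 < θ
  density : HasLowerDensityBound ((n : ℝ) + κ) δ θ M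

/-- The initial datum `2χ - 1`, where `χ` is the indicator function of `Ω`. -/
def phaseDatum {n : ℕ} (Ω : Set (EuclideanSpace ℝ (Fin (n + 1)))) :
    EuclideanSpace ℝ (Fin (n + 1)) → ℝ :=
  fun x => 2 * Ω.indicator (fun _ => (1 : ℝ)) x - 1

/-- The double-well potential `F(u) = (1 - u²)² / 2`. -/
def wellPotential (v : ℝ) : ℝ := (1 - v ^ 2) ^ 2 / 2

/-- `u t x` is a solution of `∂ₜ u = Δ u - ε⁻² F'(u)` on `ℝ^{n+1} × (0, ∞)` with initial
datum `u₀`: it is bounded on `ℝ^{n+1} × (0, T]` for every `T`, smooth for positive times, and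
tends to `u₀` in the sense of distributions as `t ↓ 0`. -/
structure IsAllenCahnSolution {n : ℕ} (ε : ℝ) (u₀ : EuclideanSpace ℝ (Fin (n + 1)) → ℝ)
    (u : ℝ → EuclideanSpace ℝ (Fin (n + 1)) → ℝ) : Prop where
  bounded : ∀ T > 0, ∃ K : ℝ, ∀ t ∈ Ioc 0 T, ∀ x, |u t x| ≤ K
  smooth : ContDiffOn ℝ ∞ (fun p : ℝ × EuclideanSpace ℝ (Fin (n + 1)) => u p.1 p.2)
    (Ioi (0 : ℝ) ×ˢ univ)
  equation : ∀ t > 0, ∀ x,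
    deriv (fun s => u s x) t =
      Laplacian.laplacian (u t) x - 1 / ε ^ 2 * deriv wellPotential (u t x)
  initial : ∀ φ : EuclideanSpace ℝ (Fin (n + 1)) → ℝ, ContDiff ℝ ∞ φ → HasCompactSupport φ →
    Tendsto (fun t => ∫ x, u t x * φ x) (𝓝[>] 0) (𝓝 (∫ x, u₀ x * φ x))

/-- The Allen–Cahn energy `∫ ε |Dv|² / 2 + F(v) / ε dx`, with values in `[0, ∞]`. -/
def allenCahnEnergy {n : ℕ} (ε : ℝ) (v : EuclideanSpace ℝ (Fin (n + 1)) → ℝ) : ℝ≥0∞ :=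
  ∫⁻ x, ENNReal.ofReal (ε * ‖gradient v x‖ ^ 2 / 2 + wellPotential (v x) / ε)

end

/-! The equation is `∂ₜU = ΔU + L(U - U³)` with `L = 2/ε²`. On a time interval of length `ε²` the
reaction costs only a factor `exp(2Lt) ≤ e⁴`, so up to constants the solution behaves like the heat
flow of `2χ - 1`: the phases mix only within distance about `√t` of `M`. There `|DU|²` is of order
`1/t`, so the energy density is at most of order `ε/t + 1/ε`. By the density bound and `ℋⁿ(M) < ∞`,
the layer has volume of order `√t`, which gives `ε/√t + √t/ε`.

The pointwise estimate is `bernstein_decay`. If `U₀ = -1` on the ball of radius `d` about `x`, then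
`t (∂ᵢU)² + (1 + U)²` at `(t, x)` is at most a constant times `exp(2Lt) (t/(d² + t))^(n+2)`. A
Bernstein quantity combining both terms is a subsolution of `∂ₜ - Δ - 2L`, and it is compared with a
polynomial supersolution that is at least `1` outside the ball. The other phase follows by replacing
`U` with `-U`. The exponent `n + 2` makes the bound integrable over `ℝⁿ⁺¹`; a covering of `M` by
about `t^(-n/2)` balls of radius comparable to `√t` turns it into a finite sum of integrable
profiles (`allenCahnEnergy_le_of_cover`).

The initial values are attained only as distributions. Averaging in space gives functions continuous
up to time `0`, to which the maximum principle applies (`le_mul_of_heat_le`); an error linear in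
time remains from the crude bound on the reaction, and it vanishes by restarting at time `s` and
letting `s` tend to `0`.

For `t ≥ ε²` the energy does not increase. Since the space is unbounded, the energy identity is
localised with cutoffs; their error vanishes because the covering estimate already bounds the energy
on compact time intervals (`allenCahnEnergy_antitone`). -/

/-! ### Directional derivatives and the heat operator -/

section DirectionalDerivative

variable {X : Type*} [NormedAddCommGroup X] [NormedSpace ℝ X]

/-- The derivative of `f` at `p` in the direction `v`. -/
noncomputable def dirDeriv (v : X) (f : X → ℝ) (p : X) : ℝ := fderiv ℝ f p v

theorem ContDiffAt.dirDeriv {m k : ℕ∞ω} {f : X → ℝ} {p : X} (hf : ContDiffAt ℝ k f p)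
    (hmk : m + 1 ≤ k) (v : X) : ContDiffAt ℝ m (dirDeriv v f) p :=
  (hf.fderiv_right hmk).clm_apply contDiffAt_const

theorem ContDiffAt.eventually_differentiableAt {k : ℕ∞ω} {f : X → ℝ} {p : X}
    (hf : ContDiffAt ℝ k f p) (hk : 1 ≤ k) : ∀ᶠ q in 𝓝 p, DifferentiableAt ℝ f q :=
  ((hf.of_le hk).eventually (by simp)).mono fun _ h => h.differentiableAt (by simp)

theorem dirDeriv_congr {f g : X → ℝ} {p : X} (h : f =ᶠ[𝓝 p] g) (v : X) :
    dirDeriv v f p = dirDeriv v g p := by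
  simp only [dirDeriv, h.fderiv_eq]

theorem dirDeriv_eventuallyEq {f g : X → ℝ} {p : X} (h : f =ᶠ[𝓝 p] g) (v : X) :
    dirDeriv v f =ᶠ[𝓝 p] dirDeriv v g :=
  (h.fderiv (𝕜 := ℝ)).mono fun q hq => by simp only [dirDeriv, hq]

theorem dirDeriv_add {f g : X → ℝ} {p : X} (hf : DifferentiableAt ℝ f p)
    (hg : DifferentiableAt ℝ g p) (v : X) :
    dirDeriv v (fun q => f q + g q) p = dirDeriv v f p + dirDeriv v g p := by
  simp [dirDeriv, fderiv_fun_add hf hg]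

theorem dirDeriv_mul {f g : X → ℝ} {p : X} (hf : DifferentiableAt ℝ f p)
    (hg : DifferentiableAt ℝ g p) (v : X) :
    dirDeriv v (fun q => f q * g q) p = f p * dirDeriv v g p + dirDeriv v f p * g p := by
  simp [dirDeriv, fderiv_fun_mul hf hg, mul_comm]

theorem dirDeriv_const (c : ℝ) (v : X) (p : X) : dirDeriv v (fun _ => c) p = 0 := by
  simp [dirDeriv]

theorem dirDeriv_comp {φ : ℝ → ℝ} {f : X → ℝ} {p : X} (hφ : DifferentiableAt ℝ φ (f p))
    (hf : DifferentiableAt ℝ f p) (v : X) :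
    dirDeriv v (fun q => φ (f q)) p = deriv φ (f p) * dirDeriv v f p := by
  have := (hφ.hasDerivAt.comp_hasFDerivAt p hf.hasFDerivAt).fderiv
  simp only [Function.comp_def] at this
  simp [dirDeriv, this]

theorem hasDerivAt_line {f : X → ℝ} {p v : X} {r : ℝ} (hf : DifferentiableAt ℝ f (p + r • v)) :
    HasDerivAt (fun r : ℝ => f (p + r • v)) (dirDeriv v f (p + r • v)) r := by
  have h : HasDerivAt (fun r : ℝ => p + r • v) v r := by
    simpa using ((hasDerivAt_id r).smul_const v).const_add p
  exact hf.hasFDerivAt.comp_hasDerivAt r h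

theorem dirDeriv_dirDeriv_add {f g : X → ℝ} {p : X} (hf : ContDiffAt ℝ 2 f p)
    (hg : ContDiffAt ℝ 2 g p) (v w : X) :
    dirDeriv v (dirDeriv w fun q => f q + g q) p =
      dirDeriv v (dirDeriv w f) p + dirDeriv v (dirDeriv w g) p := by
  rw [dirDeriv_congr (g := fun q => dirDeriv w f q + dirDeriv w g q) ?_,
    dirDeriv_add ((hf.dirDeriv (m := 1) (by norm_num) w).differentiableAt (by simp))
      ((hg.dirDeriv (m := 1) (by norm_num) w).differentiableAt (by simp))]
  filter_upwards [hf.eventually_differentiableAt (by norm_num),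
    hg.eventually_differentiableAt (by norm_num)] with q h1 h2 using dirDeriv_add h1 h2 w

theorem dirDeriv_dirDeriv_mul {f g : X → ℝ} {p : X} (hf : ContDiffAt ℝ 2 f p)
    (hg : ContDiffAt ℝ 2 g p) (v : X) :
    dirDeriv v (dirDeriv v fun q => f q * g q) p =
      f p * dirDeriv v (dirDeriv v g) p + 2 * (dirDeriv v f p * dirDeriv v g p)
        + dirDeriv v (dirDeriv v f) p * g p := by
  have hf1 := hf.differentiableAt (by simp)
  have hg1 := hg.differentiableAt (by simp)
  have hf2 := (hf.dirDeriv (m := 1) (by norm_num) v).differentiableAt (by simp)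
  have hg2 := (hg.dirDeriv (m := 1) (by norm_num) v).differentiableAt (by simp)
  rw [dirDeriv_congr (g := fun q => f q * dirDeriv v g q + dirDeriv v f q * g q) ?_,
    dirDeriv_add (hf1.fun_mul hg2) (hf2.fun_mul hg1), dirDeriv_mul hf1 hg2, dirDeriv_mul hf2 hg1]
  · ring
  filter_upwards [hf.eventually_differentiableAt (by norm_num),
    hg.eventually_differentiableAt (by norm_num)] with q h1 h2 using dirDeriv_mul h1 h2 v

theorem dirDeriv_dirDeriv_comp {φ : ℝ → ℝ} {f : X → ℝ} {p : X} (hφ : ContDiff ℝ 2 φ)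
    (hf : ContDiffAt ℝ 2 f p) (v : X) :
    dirDeriv v (dirDeriv v fun q => φ (f q)) p =
      deriv φ (f p) * dirDeriv v (dirDeriv v f) p
        + deriv (deriv φ) (f p) * dirDeriv v f p ^ 2 := by
  have hf1 := hf.differentiableAt (by simp)
  have hf2 := (hf.dirDeriv (m := 1) (by norm_num) v).differentiableAt (by simp)
  have hφ1 : Differentiable ℝ φ := hφ.differentiable (by simp)
  have hφ2 : Differentiable ℝ (deriv φ) :=
    ((contDiff_succ_iff_deriv (n := 1)).1 (by rw [one_add_one_eq_two]; exact hφ)).2.2.differentiable (by simp)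
  have h3 : DifferentiableAt ℝ (fun q => deriv φ (f q)) p := (hφ2 (f p)).fun_comp' p hf1
  rw [dirDeriv_congr (g := fun q => deriv φ (f q) * dirDeriv v f q) ?_,
    dirDeriv_mul h3 hf2, dirDeriv_comp (hφ2 _) hf1]
  · ring
  filter_upwards [hf.eventually_differentiableAt (by norm_num)] with q h1
    using dirDeriv_comp (hφ1 _) h1 v

theorem dirDeriv_comm {f : X → ℝ} {p : X} (hf : ContDiffAt ℝ 2 f p) (v w : X) :
    dirDeriv v (dirDeriv w f) p = dirDeriv w (dirDeriv v f) p := by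
  have hd : DifferentiableAt ℝ (fderiv ℝ f) p :=
    (hf.fderiv_right (m := 1) (by norm_num)).differentiableAt (by simp)
  have h : ∀ v w : X, dirDeriv v (dirDeriv w f) p = fderiv ℝ (fderiv ℝ f) p v w := by
    intro v w
    have := (hd.hasFDerivAt.clm_apply (hasFDerivAt_const w p)).fderiv
    rw [dirDeriv, show dirDeriv w f = fun q => fderiv ℝ f q w from rfl, this]
    simp
  rw [h, h]
  exact (hf.isSymmSndFDerivAt (by simp)).eq v w

end DirectionalDerivative

/-! ### The heat operator: product and chain rules, model functions -/

section HeatOperator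

/-- Space-time `ℝ × ℝ^{n+1}`. -/
abbrev SpaceTime (n : ℕ) := ℝ × EuclideanSpace ℝ (Fin (n + 1))

/-- The unit vector in the time direction. -/
def timeDir (n : ℕ) : SpaceTime n := (1, 0)

/-- The `i`-th unit vector in the space directions. -/
noncomputable def spaceDir {n : ℕ} (i : Fin (n + 1)) : SpaceTime n :=
  (0, EuclideanSpace.single i 1)

variable {n : ℕ}

/-- The heat operator `∂ₜ - Δ`. -/
noncomputable def heat (f : SpaceTime n → ℝ) (p : SpaceTime n) : ℝ :=
  dirDeriv (timeDir n) f p - ∑ i, dirDeriv (spaceDir i) (dirDeriv (spaceDir i) f) p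

/-- The squared length of the spatial gradient. -/
noncomputable def gradSq (f : SpaceTime n → ℝ) (p : SpaceTime n) : ℝ :=
  ∑ i, dirDeriv (spaceDir i) f p ^ 2

theorem gradSq_nonneg (f : SpaceTime n → ℝ) (p : SpaceTime n) : 0 ≤ gradSq f p :=
  Finset.sum_nonneg fun _ _ => sq_nonneg _

theorem heat_add {f g : SpaceTime n → ℝ} {p : SpaceTime n} (hf : ContDiffAt ℝ 2 f p)
    (hg : ContDiffAt ℝ 2 g p) : heat (fun q => f q + g q) p = heat f p + heat g p := by
  simp only [heat, dirDeriv_dirDeriv_add hf hg, Finset.sum_add_distrib,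
    dirDeriv_add (hf.differentiableAt (by simp)) (hg.differentiableAt (by simp))]
  ring

theorem heat_mul {f g : SpaceTime n → ℝ} {p : SpaceTime n} (hf : ContDiffAt ℝ 2 f p)
    (hg : ContDiffAt ℝ 2 g p) : heat (fun q => f q * g q) p = f p * heat g p + heat f p * g p
      - 2 * ∑ i, dirDeriv (spaceDir i) f p * dirDeriv (spaceDir i) g p := by
  simp only [heat, dirDeriv_dirDeriv_mul hf hg, Finset.sum_add_distrib, ← Finset.mul_sum,
    ← Finset.sum_mul, dirDeriv_mul (hf.differentiableAt (by simp)) (hg.differentiableAt (by simp))]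
  ring

theorem heat_comp {φ : ℝ → ℝ} {f : SpaceTime n → ℝ} {p : SpaceTime n} (hφ : ContDiff ℝ 2 φ)
    (hf : ContDiffAt ℝ 2 f p) : heat (fun q => φ (f q)) p =
      deriv φ (f p) * heat f p - deriv (deriv φ) (f p) * gradSq f p := by
  simp only [heat, gradSq, dirDeriv_dirDeriv_comp hφ hf, Finset.sum_add_distrib, ← Finset.mul_sum,
    dirDeriv_comp (hφ.differentiable (by simp) _) (hf.differentiableAt (by simp))]
  ring

theorem heat_const (c : ℝ) (p : SpaceTime n) : heat (fun _ => c) p = 0 := by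
  have h : ∀ v : SpaceTime n, dirDeriv v (fun _ : SpaceTime n => c) = fun _ => 0 :=
    fun v => funext fun q => dirDeriv_const c v q
  simp [heat, h, dirDeriv_const]

theorem heat_const_mul (c : ℝ) {f : SpaceTime n → ℝ} {p : SpaceTime n}
    (hf : ContDiffAt ℝ 2 f p) : heat (fun q => c * f q) p = c * heat f p := by
  rw [heat_mul contDiffAt_const hf, heat_const]
  simp [dirDeriv_const]

theorem heat_sub {f g : SpaceTime n → ℝ} {p : SpaceTime n} (hf : ContDiffAt ℝ 2 f p)
    (hg : ContDiffAt ℝ 2 g p) : heat (fun q => f q - g q) p = heat f p - heat g p := by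
  have := heat_add hf (contDiffAt_const.mul hg : ContDiffAt ℝ 2 (fun q => (-1 : ℝ) * g q) p)
  rw [heat_const_mul (-1) hg] at this
  simpa [sub_eq_add_neg] using this

theorem heat_sq {f : SpaceTime n → ℝ} {p : SpaceTime n} (hf : ContDiffAt ℝ 2 f p) :
    heat (fun q => f q ^ 2) p = 2 * f p * heat f p - 2 * gradSq f p := by
  simp only [pow_two (f _), heat_mul hf hf, gradSq]
  simp only [pow_two]
  ring

/-- A function of time only. -/
theorem dirDeriv_spaceDir_time (φ : ℝ → ℝ) (i : Fin (n + 1)) (p : SpaceTime n)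
    (hφ : Differentiable ℝ φ) : dirDeriv (spaceDir i) (fun q : SpaceTime n => φ q.1) p = 0 := by
  rw [dirDeriv_comp (f := fun q : SpaceTime n => q.1) (hφ _) differentiableAt_fst]
  simp [dirDeriv, spaceDir, fderiv_fst]

theorem heat_time {φ : ℝ → ℝ} (hφ : Differentiable ℝ φ) (p : SpaceTime n) :
    heat (fun q : SpaceTime n => φ q.1) p = deriv φ p.1 := by
  have h : ∀ i : Fin (n + 1), dirDeriv (spaceDir i) (fun q : SpaceTime n => φ q.1) =
      fun _ => 0 := fun i => funext fun q => dirDeriv_spaceDir_time φ i q hφ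
  simp only [heat, h, dirDeriv_const, Finset.sum_const_zero, sub_zero]
  rw [dirDeriv_comp (f := fun q : SpaceTime n => q.1) (hφ _) differentiableAt_fst]
  simp [dirDeriv, timeDir, fderiv_fst]

/-- The squared distance to a point of space. -/
noncomputable def distSq (x : EuclideanSpace ℝ (Fin (n + 1))) (p : SpaceTime n) : ℝ :=
  ‖p.2 - x‖ ^ 2

theorem contDiff_distSq (x : EuclideanSpace ℝ (Fin (n + 1))) {k : ℕ∞ω} :
    ContDiff ℝ k (distSq x) :=
  (contDiff_snd.sub contDiff_const).norm_sq ℝ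

theorem dirDeriv_distSq (x : EuclideanSpace ℝ (Fin (n + 1))) (v p : SpaceTime n) :
    dirDeriv v (distSq x) p = 2 * inner ℝ (p.2 - x) v.2 := by
  have h : HasFDerivAt (fun q : SpaceTime n => q.2 - x)
      (ContinuousLinearMap.snd ℝ ℝ (EuclideanSpace ℝ (Fin (n + 1)))) p :=
    hasFDerivAt_snd.sub_const x
  have := h.norm_sq.fderiv
  simp only [dirDeriv]
  rw [show distSq x = fun q : SpaceTime n => ‖q.2 - x‖ ^ 2 from rfl, this]
  simp [inner_sub_left]

theorem dirDeriv_spaceDir_distSq (x : EuclideanSpace ℝ (Fin (n + 1))) (i : Fin (n + 1))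
    (p : SpaceTime n) : dirDeriv (spaceDir i) (distSq x) p = 2 * (p.2 - x) i := by
  rw [dirDeriv_distSq, spaceDir]
  simp [EuclideanSpace.inner_single_right]

theorem gradSq_distSq (x : EuclideanSpace ℝ (Fin (n + 1))) (p : SpaceTime n) :
    gradSq (distSq x) p = 4 * distSq x p := by
  simp only [gradSq, dirDeriv_spaceDir_distSq, distSq, EuclideanSpace.real_norm_sq_eq,
    Finset.mul_sum]
  exact Finset.sum_congr rfl fun i _ => by ring

theorem heat_distSq (x : EuclideanSpace ℝ (Fin (n + 1))) (p : SpaceTime n) :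
    heat (distSq x) p = -(2 * (n + 1)) := by
  have h : ∀ i : Fin (n + 1), dirDeriv (spaceDir i) (dirDeriv (spaceDir i) (distSq x)) p = 2 := by
    intro i
    have e : dirDeriv (spaceDir i) (distSq x) =
        fun q : SpaceTime n => 2 * inner ℝ (q.2 - x) (spaceDir i : SpaceTime n).2 :=
      funext fun q => dirDeriv_distSq x _ q
    have h1 : HasFDerivAt (fun q : SpaceTime n => q.2 - x)
        (ContinuousLinearMap.snd ℝ ℝ (EuclideanSpace ℝ (Fin (n + 1)))) p :=
      hasFDerivAt_snd.sub_const x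
    have h2 := (h1.inner ℝ (hasFDerivAt_const (spaceDir i : SpaceTime n).2 p)).const_mul 2
    rw [e, dirDeriv, h2.fderiv]
    simp [spaceDir]
  simp only [heat, h]
  rw [dirDeriv_distSq]
  simp [timeDir]
  ring

end HeatOperator

/-! ### The maximum principle on cylinders -/

/-- One-sided, since a maximum over a closed cylinder may lie at the final time. -/
theorem deriv_nonneg_of_eventually_le_left {h : ℝ → ℝ} {D r : ℝ} (hd : HasDerivAt h D r)
    (hr : ∀ᶠ x in 𝓝[<] r, h x ≤ h r) : 0 ≤ D := by
  have ht := (hasDerivWithinAt_iff_tendsto_slope' (s := Iio r) (by simp)).1 hd.hasDerivWithinAt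
  refine ge_of_tendsto ht ?_
  filter_upwards [hr, self_mem_nhdsWithin] with x h1 h2
  rw [slope_def_field]
  exact div_nonneg_of_nonpos (by linarith) (by linarith [show x < r from h2])

/-- A positive second derivative would make the point a local minimum as well, hence the function
locally constant, a contradiction. -/
theorem IsLocalMax.deriv_deriv_nonpos {h : ℝ → ℝ} {r : ℝ} (hm : IsLocalMax h r)
    (hc : ContinuousAt h r) : deriv (deriv h) r ≤ 0 := by
  by_contra! hpos
  have hmin := isLocalMin_of_deriv_deriv_pos hpos hm.deriv_eq_zero hc
  have heq : h =ᶠ[𝓝 r] fun _ => h r := by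
    filter_upwards [hm, hmin] with x h1 h2 using le_antisymm h1 h2
  have := heq.deriv.deriv_eq
  simp [this] at hpos

section MaximumPrinciple

variable {n : ℕ}

theorem dirDeriv_dirDeriv_nonpos_of_isLocalMax_line {v : SpaceTime n → ℝ} {p e : SpaceTime n}
    (hv : ContDiffAt ℝ 2 v p) (hm : IsLocalMax (fun r : ℝ => v (p + r • e)) 0) :
    dirDeriv e (dirDeriv e v) p ≤ 0 := by
  have hcont : Tendsto (fun r : ℝ => p + r • e) (𝓝 0) (𝓝 p) := by
    have : Continuous fun r : ℝ => p + r • e := by fun_prop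
    simpa using this.tendsto 0
  have h1 : ∀ᶠ r in 𝓝 (0 : ℝ), DifferentiableAt ℝ v (p + r • e) :=
    hcont.eventually (hv.eventually_differentiableAt (by norm_num))
  have h2 : deriv (fun r : ℝ => v (p + r • e)) =ᶠ[𝓝 0] fun r => dirDeriv e v (p + r • e) :=
    h1.mono fun r hr => (hasDerivAt_line hr).deriv
  have h3 : DifferentiableAt ℝ (dirDeriv e v) (p + (0 : ℝ) • e) := by
    simpa using (hv.dirDeriv (m := 1) (by norm_num) e).differentiableAt (by simp)
  have h4 := hm.deriv_deriv_nonpos (hasDerivAt_line h1.self_of_nhds).continuousAt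
  rw [h2.deriv_eq, (hasDerivAt_line h3).deriv] at h4
  simpa using h4

/-- The weak maximum principle for `∂ₜ - Δ - L` on a compact cylinder; the differential
inequality is only needed where the function is positive. -/
theorem nonpos_of_heat_le {s T R L : ℝ} {x₀ : EuclideanSpace ℝ (Fin (n + 1))}
    {v : SpaceTime n → ℝ} (hc : ContinuousOn v (Icc s T ×ˢ Metric.closedBall x₀ R))
    (hd : ∀ t ∈ Ioc s T, ∀ y ∈ Metric.ball x₀ R, 0 < v (t, y) →
      ContDiffAt ℝ 2 v (t, y) ∧ heat v (t, y) ≤ L * v (t, y))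
    (h0 : ∀ y ∈ Metric.closedBall x₀ R, v (s, y) ≤ 0)
    (hs : ∀ t ∈ Icc s T, ∀ y ∈ Metric.sphere x₀ R, v (t, y) ≤ 0) :
    ∀ t ∈ Icc s T, ∀ y ∈ Metric.closedBall x₀ R, v (t, y) ≤ 0 := by
  intro t₀ ht₀ y₀ hy₀
  by_contra! hpos
  have hK : IsCompact (Icc s T ×ˢ Metric.closedBall x₀ R) :=
    isCompact_Icc.prod (isCompact_closedBall _ _)
  -- At a positive maximum of `exp(-(L+1)t) v`, the time derivative of `v` is at least `(L+1)v` and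
  -- its Laplacian is nonpositive, which contradicts `heat v ≤ L v`. The extra `1` in the exponent
  -- makes the contradiction strict.
  have hgc : ContinuousOn (fun p : SpaceTime n => Real.exp (-(L + 1) * p.1) * v p)
      (Icc s T ×ˢ Metric.closedBall x₀ R) :=
    (by fun_prop : Continuous fun p : SpaceTime n => Real.exp (-(L + 1) * p.1)).continuousOn.mul hc
  obtain ⟨⟨t, y⟩, ⟨ht, hy⟩, hmax⟩ := hK.exists_isMaxOn ⟨(t₀, y₀), ht₀, hy₀⟩ hgc
  have hmax' : ∀ r ∈ Icc s T, ∀ z ∈ Metric.closedBall x₀ R,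
      Real.exp (-(L + 1) * r) * v (r, z) ≤ Real.exp (-(L + 1) * t) * v (t, y) :=
    fun r hr z hz => hmax (show (r, z) ∈ _ from ⟨hr, hz⟩)
  simp only at ht hy
  have hvp : 0 < v (t, y) := by
    have h1 := hmax' t₀ ht₀ y₀ hy₀
    have h2 : 0 < Real.exp (-(L + 1) * t₀) * v (t₀, y₀) := by positivity
    exact pos_of_mul_pos_right (h2.trans_le h1) (Real.exp_pos _).le
  have hts : s < t := lt_of_le_of_ne ht.1 fun h => by
    subst h; exact absurd (h0 y hy) (not_le.2 hvp)
  have hyb : y ∈ Metric.ball x₀ R := by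
    rcases eq_or_lt_of_le (Metric.mem_closedBall.1 hy) with h | h
    · exact absurd (hs t ht y h) (not_le.2 hvp)
    · exact h
  obtain ⟨hv2, hle⟩ := hd t ⟨hts, ht.2⟩ y hyb hvp
  have htime : (L + 1) * v (t, y) ≤ dirDeriv (timeDir n) v (t, y) := by
    have h1 := (hv2.differentiableAt (by simp))
    have h2 : DifferentiableAt ℝ v ((t, y) + (0 : ℝ) • timeDir n) := by simpa using h1
    have h3 : HasDerivAt (fun r : ℝ => Real.exp (-(L + 1) * (t + r)))
        (Real.exp (-(L + 1) * (t + 0)) * (-(L + 1) * 1)) 0 :=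
      (((hasDerivAt_id (0 : ℝ)).const_add t).const_mul (-(L + 1))).exp
    have h4 := deriv_nonneg_of_eventually_le_left (h3.mul (hasDerivAt_line h2)) (by
      have : Ioo (s - t) 0 ∈ 𝓝[<] (0 : ℝ) := Ioo_mem_nhdsLT (by linarith)
      filter_upwards [this] with r hr
      have := hmax' (t + r) ⟨by linarith [hr.1], by linarith [hr.2, ht.2]⟩ y hy
      simpa [timeDir] using this)
    simp only [zero_smul, add_zero, mul_one] at h4
    have h5 : 0 ≤ Real.exp (-(L + 1) * t) * (dirDeriv (timeDir n) v (t, y) - (L + 1) * v (t, y)) := by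
      linarith
    have := nonneg_of_mul_nonneg_right h5 (Real.exp_pos _)
    linarith
  have hspace : ∀ i : Fin (n + 1), dirDeriv (spaceDir i) (dirDeriv (spaceDir i) v) (t, y) ≤ 0 := by
    intro i
    refine dirDeriv_dirDeriv_nonpos_of_isLocalMax_line hv2 ?_
    have hcont : Continuous fun r : ℝ => y + r • (EuclideanSpace.single i 1 :
        EuclideanSpace ℝ (Fin (n + 1))) := by fun_prop
    have hev : ∀ᶠ r in 𝓝 (0 : ℝ), y + r • (EuclideanSpace.single i 1 :
        EuclideanSpace ℝ (Fin (n + 1))) ∈ Metric.ball x₀ R :=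
      hcont.continuousAt.eventually_mem (Metric.isOpen_ball.mem_nhds (by simpa using hyb))
    filter_upwards [hev] with r hr
    have := le_of_mul_le_mul_left (hmax' t ht _ (Metric.ball_subset_closedBall hr)) (Real.exp_pos _)
    simpa [spaceDir] using this
  have hsum := Finset.sum_nonpos fun i (_ : i ∈ Finset.univ) => hspace i
  simp only [heat] at hle
  linarith

/-- The operator has constant coefficients and derivatives commute. This allows the equation to be
differentiated. -/
theorem heat_dirDeriv {f : SpaceTime n → ℝ} {p : SpaceTime n} (hf : ContDiffAt ℝ 3 f p)
    (v : SpaceTime n) : heat (dirDeriv v f) p = dirDeriv v (heat f) p := by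
  have h2 : ContDiffAt ℝ 2 f p := hf.of_le (by norm_num)
  have hev : ∀ᶠ q in 𝓝 p, ContDiffAt ℝ 2 f q := h2.eventually (by simp)
  have hd : ∀ w : SpaceTime n, ContDiffAt ℝ 2 (dirDeriv w f) p := fun w => hf.dirDeriv (by norm_num) w
  have hdd : ∀ w : SpaceTime n, DifferentiableAt ℝ (dirDeriv w (dirDeriv w f)) p := fun w =>
    ((hd w).dirDeriv (m := 1) (by norm_num) w).differentiableAt (by simp)
  have hsum : DifferentiableAt ℝ
      (fun q => ∑ i, dirDeriv (spaceDir i) (dirDeriv (spaceDir i) f) q) p :=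
    DifferentiableAt.fun_sum fun i _ => hdd _
  have key : ∀ w : SpaceTime n, dirDeriv w (dirDeriv w (dirDeriv v f)) p =
      dirDeriv v (dirDeriv w (dirDeriv w f)) p := by
    intro w
    rw [dirDeriv_congr (hev.mono fun q hq => dirDeriv_comm hq w v) w, dirDeriv_comm (hd w)]
  have hT : DifferentiableAt ℝ (dirDeriv (timeDir n) f) p := (hd _).differentiableAt (by simp)
  have hR : dirDeriv v (heat f) p = dirDeriv v (dirDeriv (timeDir n) f) p -
      ∑ i, dirDeriv v (dirDeriv (spaceDir i) (dirDeriv (spaceDir i) f)) p := by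
    rw [dirDeriv, show heat f = fun q => dirDeriv (timeDir n) f q -
      ∑ i, dirDeriv (spaceDir i) (dirDeriv (spaceDir i) f) q from rfl, fderiv_fun_sub hT hsum,
      fderiv_fun_sum fun i _ => hdd _]
    simp [dirDeriv]
  rw [hR, heat, dirDeriv_comm h2]
  simp only [key]

end MaximumPrinciple

/-! ### Spatial averages -/

section Averages

variable {n : ℕ}

theorem contDiffAt_of_slab {k : ℕ∞ω} {I : Set ℝ} (hI : IsOpen I) {G : SpaceTime n → ℝ}
    (hG : ContDiffOn ℝ k G (I ×ˢ univ)) {r : ℝ} (hr : r ∈ I)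
    (y : EuclideanSpace ℝ (Fin (n + 1))) : ContDiffAt ℝ k G (r, y) :=
  hG.contDiffAt ((hI.prod isOpen_univ).mem_nhds ⟨hr, mem_univ _⟩)

theorem ContDiffOn.dirDeriv_slab {m k : ℕ∞ω} {I : Set ℝ} (hI : IsOpen I) {G : SpaceTime n → ℝ}
    (hG : ContDiffOn ℝ k G (I ×ˢ univ)) (hmk : m + 1 ≤ k) (v : SpaceTime n) :
    ContDiffOn ℝ m (dirDeriv v G) (I ×ˢ univ) := fun p hp =>
  ((contDiffAt_of_slab hI hG hp.1 p.2).dirDeriv hmk v).contDiffWithinAt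

theorem continuous_slice {I : Set ℝ} {G : SpaceTime n → ℝ}
    (hG : ContinuousOn G (I ×ˢ univ)) {r : ℝ} (hr : r ∈ I) : Continuous fun y => G (r, y) :=
  hG.comp_continuous (by fun_prop) fun y => ⟨hr, mem_univ y⟩

/-- Differentiation in time under an integral with a compactly supported weight. -/
theorem hasDerivAt_integral_mul {I : Set ℝ} (hI : IsOpen I)
    {φ : EuclideanSpace ℝ (Fin (n + 1)) → ℝ} (hφ : Continuous φ) (hφc : HasCompactSupport φ)
    {G : SpaceTime n → ℝ} (hG : ContDiffOn ℝ 1 G (I ×ˢ univ)) {r₀ : ℝ} (hr₀ : r₀ ∈ I) :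
    HasDerivAt (fun r => ∫ y, φ y * G (r, y)) (∫ y, φ y * dirDeriv (timeDir n) G (r₀, y)) r₀ := by
  obtain ⟨ε, hε, hsub⟩ := Metric.nhds_basis_closedBall.mem_iff.1 (hI.mem_nhds hr₀)
  have hG' : ContinuousOn (dirDeriv (timeDir n) G) (I ×ˢ univ) :=
    (ContDiffOn.dirDeriv_slab (m := 0) hI hG (by simp) _).continuousOn
  have hK : IsCompact (Metric.closedBall r₀ ε ×ˢ tsupport φ) :=
    (isCompact_closedBall _ _).prod hφc
  obtain ⟨C, hC⟩ := hK.exists_bound_of_continuousOn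
    (hG'.mono (prod_mono hsub (subset_univ _)))
  have hint : ∀ {H : SpaceTime n → ℝ}, ContinuousOn H (I ×ˢ univ) → ∀ r ∈ I,
      Integrable fun y => φ y * H (r, y) := fun hH r hr =>
    (hφ.mul (continuous_slice hH hr)).integrable_of_hasCompactSupport hφc.mul_right
  refine (hasDerivAt_integral_of_dominated_loc_of_deriv_le (bound := fun y => |φ y| * C)
    (F' := fun r y => φ y * dirDeriv (timeDir n) G (r, y))
    (Metric.closedBall_mem_nhds r₀ hε) ?_ (hint hG.continuousOn _ hr₀)
    (hint hG' _ hr₀).aestronglyMeasurable ?_ ?_ ?_).2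
  · filter_upwards [hI.mem_nhds hr₀] with r hr
    exact (hint hG.continuousOn r hr).aestronglyMeasurable
  · refine Eventually.of_forall fun y r hr => ?_
    rw [norm_mul, Real.norm_eq_abs]
    by_cases hy : y ∈ tsupport φ
    · exact mul_le_mul_of_nonneg_left (hC (r, y) ⟨hr, hy⟩) (abs_nonneg _)
    · simp [image_eq_zero_of_notMem_tsupport hy]
  · exact (hφ.abs.mul continuous_const).integrable_of_hasCompactSupport
      (hφc.comp_left (g := abs) abs_zero).mul_right
  · refine Eventually.of_forall fun y r hr => ?_
    have hd := (contDiffAt_of_slab hI hG (hsub hr) y).differentiableAt (by simp)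
    have h1 : HasDerivAt (fun r : ℝ => ((r, y) : SpaceTime n)) (timeDir n) r :=
      (hasDerivAt_id r).prodMk (hasDerivAt_const r y)
    exact (hd.hasFDerivAt.comp_hasDerivAt r h1).const_mul (φ y)

/-- The average of `g` over space translations, with weight `φ`. -/
noncomputable def spaceAvg (φ : EuclideanSpace ℝ (Fin (n + 1)) → ℝ) (g : SpaceTime n → ℝ)
    (q : SpaceTime n) : ℝ :=
  ∫ y, φ y * g (q + (0, y))

/-- The average is the value at `0` of the convolution of the constant `1` with `y ↦ φ(-y) g(q + (0,
-y))`, whose support stays in a fixed compact set as `q` varies; smoothness in the parameter `q` is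
then the parametric convolution theorem. -/
theorem contDiffOn_spaceAvg {k : ℕ∞} {I : Set ℝ} (hI : IsOpen I)
    {φ : EuclideanSpace ℝ (Fin (n + 1)) → ℝ} (hφ : ContDiff ℝ k φ) (hφc : HasCompactSupport φ)
    {g : SpaceTime n → ℝ} (hg : ContDiffOn ℝ k g (I ×ˢ univ)) :
    ContDiffOn ℝ k (spaceAvg φ g) (I ×ˢ univ) := by
  have := contDiffOn_convolution_right_with_param_comp (μ := volume)
    (ContinuousLinearMap.mul ℝ ℝ) (s := I ×ˢ (univ : Set (EuclideanSpace ℝ (Fin (n + 1)))))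
    (v := fun _ => (0 : EuclideanSpace ℝ (Fin (n + 1)))) (n := k) contDiffOn_const
    (f := fun _ => (1 : ℝ)) (g := fun q y => φ (-y) * g (q + (0, -y)))
    (k := -(tsupport φ)) (hI.prod isOpen_univ) (IsCompact.neg hφc) ?_
    (locallyIntegrable_const 1) ?_
  · refine this.congr fun q hq => ?_
    simp [spaceAvg, convolution]
  · intro q y _ hy
    rw [image_eq_zero_of_notMem_tsupport (f := φ) (x := -y) (by simpa using hy), zero_mul]
  · refine ContDiffOn.mul (hφ.comp (by fun_prop)).contDiffOn ?_
    refine hg.comp (f := fun z : SpaceTime n × EuclideanSpace ℝ (Fin (n + 1)) =>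
      z.1 + ((0 : ℝ), -z.2)) (by fun_prop) ?_
    rintro ⟨q, y⟩ ⟨hq, -⟩
    exact ⟨by simpa using hq.1, mem_univ _⟩

theorem dirDeriv_spaceAvg {I : Set ℝ} (hI : IsOpen I)
    {φ : EuclideanSpace ℝ (Fin (n + 1)) → ℝ} (hφ : ContDiff ℝ 1 φ) (hφc : HasCompactSupport φ)
    {g : SpaceTime n → ℝ} (hg : ContDiffOn ℝ 1 g (I ×ˢ univ)) (v : SpaceTime n)
    {q : SpaceTime n} (hq : q.1 ∈ I) :
    dirDeriv v (spaceAvg φ g) q = spaceAvg φ (dirDeriv v g) q := by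
  have hdiff : DifferentiableAt ℝ (spaceAvg φ g) (q + (0 : ℝ) • v) := by
    have := (contDiffAt_of_slab hI (contDiffOn_spaceAvg (k := 1) hI hφ hφc hg) hq q.2)
    simpa using this.differentiableAt (by simp)
  have h1 := hasDerivAt_line hdiff
  -- Sliding along `v` makes `r` play the role of time for `g ∘ A`, so differentiation under the
  -- integral in the time variable covers every direction.
  set A : SpaceTime n → SpaceTime n := fun z => q + z.1 • v + (0, z.2) with hA
  have hAd : ContDiff ℝ 1 A := by fun_prop
  set J : Set ℝ := (fun r : ℝ => q.1 + r * v.1) ⁻¹' I with hJ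
  have hJo : IsOpen J := hI.preimage (by fun_prop)
  have hAmaps : MapsTo A (J ×ˢ univ) (I ×ˢ univ) := by
    rintro ⟨r, y⟩ ⟨hr, -⟩
    exact ⟨by simpa [hA, hJ] using hr, mem_univ _⟩
  have h0 : (0 : ℝ) ∈ J := by simpa [hJ] using hq
  have h2 := hasDerivAt_integral_mul hJo hφ.continuous hφc
    (hg.comp hAd.contDiffOn hAmaps) h0
  have h3 := h1.unique (f := fun r : ℝ => spaceAvg φ g (q + r • v)) h2
  simp only [zero_smul, add_zero] at h3
  rw [h3, spaceAvg]
  refine integral_congr_ae (Eventually.of_forall fun y => ?_)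
  simp only
  congr 1
  have hgd : DifferentiableAt ℝ g (A (0, y)) := by
    have := hAmaps (show ((0 : ℝ), y) ∈ J ×ˢ univ from ⟨h0, mem_univ _⟩)
    exact (contDiffAt_of_slab hI hg this.1 (A (0, y)).2).differentiableAt (by simp)
  have hA' : HasFDerivAt A ((ContinuousLinearMap.fst ℝ ℝ _).smulRight v +
      (ContinuousLinearMap.inr ℝ ℝ _).comp (ContinuousLinearMap.snd ℝ ℝ _)) ((0 : ℝ), y) := by
    refine HasFDerivAt.add ?_ ?_
    · exact (hasFDerivAt_fst.smul_const v).const_add q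
    · exact ((ContinuousLinearMap.inr ℝ ℝ (EuclideanSpace ℝ (Fin (n + 1)))).comp
        (ContinuousLinearMap.snd ℝ ℝ _)).hasFDerivAt
  have := (hgd.hasFDerivAt.comp _ hA').fderiv
  rw [dirDeriv, this]
  simp [dirDeriv, timeDir, hA, Prod.mk_zero_zero]

theorem heat_spaceAvg {I : Set ℝ} (hI : IsOpen I)
    {φ : EuclideanSpace ℝ (Fin (n + 1)) → ℝ} (hφ : ContDiff ℝ 1 φ) (hφc : HasCompactSupport φ)
    {g : SpaceTime n → ℝ} (hg : ContDiffOn ℝ 2 g (I ×ˢ univ))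
    {q : SpaceTime n} (hq : q.1 ∈ I) :
    heat (spaceAvg φ g) q = spaceAvg φ (heat g) q := by
  have hg1 : ContDiffOn ℝ 1 g (I ×ˢ univ) := hg.of_le (by norm_num)
  have hd : ∀ v, ContDiffOn ℝ 1 (dirDeriv v g) (I ×ˢ univ) := fun v =>
    ContDiffOn.dirDeriv_slab hI hg (by norm_num) v
  have hdd : ∀ v, ContDiffOn ℝ 0 (dirDeriv v (dirDeriv v g)) (I ×ˢ univ) := fun v =>
    ContDiffOn.dirDeriv_slab hI (hd v) (by norm_num) v
  have hev : ∀ᶠ z in 𝓝 q, z.1 ∈ I := continuous_fst.continuousAt.eventually_mem (hI.mem_nhds hq)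
  have h2 : ∀ v, dirDeriv v (dirDeriv v (spaceAvg φ g)) q =
      spaceAvg φ (dirDeriv v (dirDeriv v g)) q := fun v => by
    rw [dirDeriv_congr (hev.mono fun z hz => dirDeriv_spaceAvg hI hφ hφc hg1 v hz) v,
      dirDeriv_spaceAvg hI hφ hφc (hd v) v hq]
  have hint : ∀ {H : SpaceTime n → ℝ}, ContinuousOn H (I ×ˢ univ) →
      Integrable fun y => φ y * H (q + (0, y)) := fun hH =>
    (hφ.continuous.mul (hH.comp_continuous (by fun_prop) fun y =>
      ⟨by simpa using hq, mem_univ _⟩)).integrable_of_hasCompactSupport hφc.mul_right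
  simp only [heat, h2, dirDeriv_spaceAvg hI hφ hφc hg1 _ hq, spaceAvg, mul_sub, Finset.mul_sum]
  rw [integral_sub (hint (hd _).continuousOn)
    (integrable_finsetSum _ fun i _ => hint (hdd _).continuousOn),
    integral_finsetSum _ fun i _ => hint (hdd _).continuousOn]

end Averages

theorem two_le_infty : (2 : ℕ∞ω) ≤ ((⊤ : ℕ∞) : ℕ∞ω) := by
  have : ((2 : ℕ∞) : ℕ∞ω) ≤ ((⊤ : ℕ∞) : ℕ∞ω) := WithTop.coe_le_coe.2 le_top
  exact this

/-! ### Comparison from distributional initial values -/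

section InitialLayer

variable {n : ℕ}

theorem ContDiffOn.continuousOn_heat {I : Set ℝ} (hI : IsOpen I) {g : SpaceTime n → ℝ}
    (hg : ContDiffOn ℝ 2 g (I ×ˢ univ)) : ContinuousOn (heat g) (I ×ˢ univ) := by
  have hd : ∀ v, ContDiffOn ℝ 1 (dirDeriv v g) (I ×ˢ univ) := fun v =>
    ContDiffOn.dirDeriv_slab hI hg (by norm_num) v
  exact (hd _).continuousOn.sub (continuousOn_finsetSum _ fun i _ =>
    (ContDiffOn.dirDeriv_slab (m := 0) hI (hd _) (by norm_num) _).continuousOn)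

theorem integrable_mul_translate {I : Set ℝ} {φ : EuclideanSpace ℝ (Fin (n + 1)) → ℝ}
    (hφ : Continuous φ) (hφc : HasCompactSupport φ) {H : SpaceTime n → ℝ}
    (hH : ContinuousOn H (I ×ˢ univ)) {q : SpaceTime n} (hq : q.1 ∈ I) :
    Integrable fun y => φ y * H (q + (0, y)) :=
  (hφ.mul (hH.comp_continuous (by fun_prop) fun y =>
    ⟨by simpa using hq, mem_univ _⟩)).integrable_of_hasCompactSupport hφc.mul_right

theorem spaceAvg_le {I : Set ℝ} {φ : EuclideanSpace ℝ (Fin (n + 1)) → ℝ}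
    (hφ : Continuous φ) (hφc : HasCompactSupport φ) (hφ0 : ∀ y, 0 ≤ φ y) (hφ1 : ∫ y, φ y = 1)
    {H : SpaceTime n → ℝ} (hH : ContinuousOn H (I ×ˢ univ)) {q : SpaceTime n} (hq : q.1 ∈ I)
    {c : ℝ} (hc : ∀ y, H (q.1, y) ≤ c) : spaceAvg φ H q ≤ c := by
  calc spaceAvg φ H q ≤ ∫ y, φ y * c := by
        refine integral_mono (integrable_mul_translate hφ hφc hH hq)
          ((hφ.integrable_of_hasCompactSupport hφc).mul_const c) fun y => ?_
        refine mul_le_mul_of_nonneg_left ?_ (hφ0 y)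
        have := hc (q.2 + y)
        rwa [show q + (0, y) = (q.1, q.2 + y) from Prod.ext (by simp) (by simp)]
    _ = c := by rw [integral_mul_const, hφ1, one_mul]

theorem spaceAvg_eq (φ : EuclideanSpace ℝ (Fin (n + 1)) → ℝ) (W : SpaceTime n → ℝ) (t : ℝ)
    (x : EuclideanSpace ℝ (Fin (n + 1))) :
    spaceAvg φ W (t, x) = ∫ z, φ (z - x) * W (t, z) := by
  rw [spaceAvg, ← integral_add_right_eq_self (fun z => φ (z - x) * W (t, z)) x]
  simp [add_comm]

/-- Averages of locally bounded functions are equicontinuous in space. -/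
theorem abs_integral_translate_sub_le {I : Set ℝ} {φ : EuclideanSpace ℝ (Fin (n + 1)) → ℝ}
    (hφ : ContDiff ℝ 1 φ) (hφc : HasCompactSupport φ) {W : SpaceTime n → ℝ}
    (hW : ContinuousOn W (I ×ˢ univ))
    (hb : ∀ R, ∃ C, ∀ t ∈ I, ∀ y ∈ Metric.closedBall (0 : EuclideanSpace ℝ (Fin (n + 1))) R,
      |W (t, y)| ≤ C) (x : EuclideanSpace ℝ (Fin (n + 1))) :
    ∃ A, 0 ≤ A ∧ ∀ t ∈ I, ∀ x' ∈ Metric.closedBall x 1,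
      |(∫ z, φ (z - x') * W (t, z)) - ∫ z, φ (z - x) * W (t, z)| ≤ A * dist x' x := by
  obtain ⟨Λ, hΛ⟩ := hφ.lipschitzWith_of_hasCompactSupport hφc (by simp)
  obtain ⟨r, hr⟩ := hφc.isCompact.isBounded.subset_closedBall 0
  set R := r + ‖x‖ + 1
  obtain ⟨C, hC⟩ := hb R
  refine ⟨Λ * |C| * volume.real (Metric.closedBall (0 : EuclideanSpace ℝ (Fin (n + 1))) R),
    by positivity, fun t ht x' hx' => ?_⟩
  have hx'1 : ‖x' - x‖ ≤ 1 := by simpa [dist_eq_norm] using hx'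
  have hint : ∀ w, Integrable fun z => φ (z - w) * W (t, z) := fun w =>
    ((hφ.continuous.comp (by fun_prop)).mul (continuous_slice hW ht)).integrable_of_hasCompactSupport
      (HasCompactSupport.mul_right (hφc.comp_homeomorph (Homeomorph.subRight w)))
  have hvanish : ∀ w, ‖w - x‖ ≤ 1 → ∀ z ∉ Metric.closedBall (0 : EuclideanSpace ℝ (Fin (n + 1))) R,
      φ (z - w) = 0 := by
    intro w hw z hz
    refine image_eq_zero_of_notMem_tsupport fun hmem => hz ?_
    have h1 : ‖z - w‖ ≤ r := by simpa using hr hmem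
    have h2 : ‖z‖ ≤ ‖z - w‖ + (‖w - x‖ + ‖x‖) := by
      calc ‖z‖ = ‖(z - w) + ((w - x) + x)‖ := by congr 1; abel
        _ ≤ _ := (norm_add_le _ _).trans (by gcongr; exact norm_add_le _ _)
    simp only [Metric.mem_closedBall, dist_zero_right, R]
    linarith
  rw [← integral_sub (hint _) (hint _)]
  have hbound : ∀ z, ‖φ (z - x') * W (t, z) - φ (z - x) * W (t, z)‖ ≤
      (Metric.closedBall (0 : EuclideanSpace ℝ (Fin (n + 1))) R).indicator
        (fun _ => Λ * dist x' x * |C|) z := by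
    intro z
    by_cases hz : z ∈ Metric.closedBall (0 : EuclideanSpace ℝ (Fin (n + 1))) R
    · rw [indicator_of_mem hz, ← sub_mul, norm_mul]
      have h1 := hΛ.dist_le_mul (z - x') (z - x)
      rw [dist_sub_left, dist_eq_norm] at h1
      exact mul_le_mul h1 ((hC t ht z hz).trans (le_abs_self C)) (norm_nonneg _) (by positivity)
    · rw [indicator_of_notMem hz, hvanish x' hx'1 z hz, hvanish x (by simp) z hz]
      simp
  have hind : Integrable ((Metric.closedBall (0 : EuclideanSpace ℝ (Fin (n + 1))) R).indicator
        (fun _ => Λ * dist x' x * |C|)) :=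
    (integrable_indicator_iff measurableSet_closedBall).2
      (integrableOn_const (isCompact_closedBall _ _).measure_lt_top.ne)
  refine (norm_integral_le_of_norm_le hind (Eventually.of_forall hbound)).trans_eq ?_
  rw [integral_indicator measurableSet_closedBall, setIntegral_const, smul_eq_mul]
  ring

/-- The average of `W` over space translations, extended by the average of the initial datum. -/
noncomputable def extendedAvg (φ W₀ : EuclideanSpace ℝ (Fin (n + 1)) → ℝ) (W : SpaceTime n → ℝ)
    (p : SpaceTime n) : ℝ :=
  if p.1 ≤ 0 then ∫ z, φ (z - p.2) * W₀ z else spaceAvg φ W p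

/-- At time `0`, the distributional limit gives convergence of the average at a fixed centre `x`,
and the Lipschitz bound, uniform in time, carries it to nearby centres. -/
theorem continuousOn_extendedAvg {T : ℝ} (hT : 0 < T)
    {φ W₀ : EuclideanSpace ℝ (Fin (n + 1)) → ℝ}
    (hφ : ContDiff ℝ ∞ φ) (hφc : HasCompactSupport φ) {W : SpaceTime n → ℝ}
    (hW : ContDiffOn ℝ 2 W (Ioi 0 ×ˢ univ))
    (hb : ∀ R, ∃ C, ∀ t ∈ Ioc 0 T, ∀ y ∈ Metric.closedBall (0 : EuclideanSpace ℝ (Fin (n + 1))) R,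
      |W (t, y)| ≤ C)
    (hini : ∀ ψ : EuclideanSpace ℝ (Fin (n + 1)) → ℝ, ContDiff ℝ ∞ ψ → HasCompactSupport ψ →
      Tendsto (fun t => ∫ y, ψ y * W (t, y)) (𝓝[>] 0) (𝓝 (∫ y, ψ y * W₀ y))) :
    ContinuousOn (extendedAvg φ W₀ W) (Icc 0 T ×ˢ univ) := by
  rintro ⟨t, x⟩ ⟨ht, -⟩
  simp only at ht
  rcases eq_or_lt_of_le ht.1 with h0 | h0
  swap
  · have h1 : ContinuousAt (spaceAvg φ W) (t, x) :=
      (contDiffAt_of_slab isOpen_Ioi (contDiffOn_spaceAvg (k := 2) isOpen_Ioi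
        (hφ.of_le (by exact_mod_cast le_top)) hφc hW) h0 x).continuousAt
    refine (h1.congr ?_).continuousWithinAt
    have : ∀ᶠ p : SpaceTime n in 𝓝 (t, x), 0 < p.1 :=
      continuous_fst.continuousAt.eventually_mem (isOpen_Ioi.mem_nhds h0)
    filter_upwards [this] with p hp
    simp [extendedAvg, not_le.2 hp]
  subst h0
  have hlim : ∀ w, Tendsto (fun t => ∫ z, φ (z - w) * W (t, z)) (𝓝[>] 0)
      (𝓝 (∫ z, φ (z - w) * W₀ z)) := fun w =>
    hini _ (hφ.comp (by fun_prop)) (hφc.comp_homeomorph (Homeomorph.subRight w))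
  obtain ⟨A, hA, hlip⟩ := abs_integral_translate_sub_le (I := Ioc 0 T)
    (hφ.of_le (by exact_mod_cast le_top)) hφc
    (hW.continuousOn.mono (prod_mono (fun t ht => ht.1) subset_rfl)) hb x
  have hlip0 : ∀ x' ∈ Metric.closedBall x 1,
      |(∫ z, φ (z - x') * W₀ z) - ∫ z, φ (z - x) * W₀ z| ≤ A * dist x' x := by
    intro x' hx'
    refine le_of_tendsto ((hlim x').sub (hlim x)).abs ?_
    filter_upwards [Ioc_mem_nhdsGT hT] with t ht using hlip t ht x' hx'
  rw [Metric.continuousWithinAt_iff]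
  intro η hη
  obtain ⟨d, hd, hd'⟩ := Metric.tendsto_nhdsWithin_nhds.1 (hlim x) (η / 2) (by linarith)
  refine ⟨min (min d 1) (η / (2 * (A + 1))), by positivity, ?_⟩
  rintro ⟨t, x'⟩ ⟨ht, -⟩ hdist
  simp only at ht
  rw [Prod.dist_eq, max_lt_iff] at hdist
  simp only [lt_min_iff] at hdist
  obtain ⟨⟨⟨h1, -⟩, -⟩, ⟨-, h2⟩, h3⟩ := hdist
  have h4 : A * dist x' x < η / 2 := by
    rw [lt_div_iff₀ (by positivity)] at h3
    nlinarith [dist_nonneg (x := x') (y := x)]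
  have hx' : x' ∈ Metric.closedBall x 1 := h2.le
  have e0 : extendedAvg φ W₀ W (0, x) = ∫ z, φ (z - x) * W₀ z := by simp [extendedAvg]
  rw [e0, Real.dist_eq]
  rcases eq_or_lt_of_le ht.1 with h0 | h0
  · subst h0
    have : extendedAvg φ W₀ W (0, x') = ∫ z, φ (z - x') * W₀ z := by simp [extendedAvg]
    rw [this]
    linarith [hlip0 x' hx']
  · have : extendedAvg φ W₀ W (t, x') = ∫ z, φ (z - x') * W (t, z) := by
      simp [extendedAvg, not_le.2 h0, spaceAvg_eq]
    rw [this]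
    have h5 := hlip t ⟨h0, ht.2⟩ x' hx'
    have h6 := hd' h0 h1
    rw [Real.dist_eq] at h6
    have := abs_sub_le (∫ z, φ (z - x') * W (t, z)) (∫ z, φ (z - x) * W (t, z))
      (∫ z, φ (z - x) * W₀ z)
    linarith

theorem contDiff_paraboloid (a c δ : ℝ) (x : EuclideanSpace ℝ (Fin (n + 1))) :
    ContDiff ℝ 2 fun p : SpaceTime n =>
      a + c * p.1 + δ * (distSq x p + 2 * (n + 1) * p.1) := by
  have := contDiff_distSq (k := 2) x
  fun_prop

/-- The expression `|y - x|² + 2(n+1)t` solves the heat equation, so only `c` survives. The `δ` term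
serves to dominate on the lateral boundary and is removed by `δ → 0`. -/
theorem heat_paraboloid (a c δ : ℝ) (x : EuclideanSpace ℝ (Fin (n + 1))) (p : SpaceTime n) :
    heat (fun p : SpaceTime n => a + c * p.1 + δ * (distSq x p + 2 * (n + 1) * p.1)) p = c := by
  have e1 : heat (fun q : SpaceTime n => a + c * q.1) p = c := by
    rw [heat_time (φ := fun r => a + c * r) (by fun_prop)]
    simp
  have e2 : heat (fun q : SpaceTime n => 2 * ((n : ℝ) + 1) * q.1) p = 2 * (n + 1) := by
    rw [heat_time (φ := fun r => 2 * ((n : ℝ) + 1) * r) (by fun_prop)]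
    simp
  have s1 : ContDiffAt ℝ 2 (fun q : SpaceTime n => a + c * q.1) p := by fun_prop
  have s2 : ContDiffAt ℝ 2 (fun q : SpaceTime n => 2 * ((n : ℝ) + 1) * q.1) p := by fun_prop
  have s3 := (contDiff_distSq (k := 2) x).contDiffAt (x := p)
  rw [heat_add s1 (contDiffAt_const.mul (s3.add s2)),
    heat_const_mul δ (f := fun q => distSq x q + 2 * (n + 1) * q.1) (s3.add s2),
    heat_add s3 s2, e1, e2, heat_distSq]
  ring

/-- Comparison for functions attaining their initial values in the sense of distributions. -/
theorem le_mul_of_heat_le {T K K' : ℝ} {W : SpaceTime n → ℝ}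
    {W₀ : EuclideanSpace ℝ (Fin (n + 1)) → ℝ}
    (hW : ContDiffOn ℝ 2 W (Ioi 0 ×ˢ univ))
    (hb : ∀ R, ∃ C, ∀ t ∈ Ioc 0 T, ∀ y ∈ Metric.closedBall (0 : EuclideanSpace ℝ (Fin (n + 1))) R,
      |W (t, y)| ≤ C)
    (hK : ∀ t ∈ Ioc 0 T, ∀ y, W (t, y) ≤ K)
    (hheat : ∀ t ∈ Ioc 0 T, ∀ y, heat W (t, y) ≤ K') (h0 : ∀ y, W₀ y ≤ 0)
    (hini : ∀ ψ : EuclideanSpace ℝ (Fin (n + 1)) → ℝ, ContDiff ℝ ∞ ψ → HasCompactSupport ψ →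
      Tendsto (fun t => ∫ y, ψ y * W (t, y)) (𝓝[>] 0) (𝓝 (∫ y, ψ y * W₀ y))) :
    ∀ t ∈ Ioc 0 T, ∀ x, W (t, x) ≤ K' * t := by
  intro t ht x
  have hT : 0 < T := ht.1.trans_le ht.2
  have havg : ∀ φ : EuclideanSpace ℝ (Fin (n + 1)) → ℝ, ContDiff ℝ ∞ φ → HasCompactSupport φ →
      (∀ y, 0 ≤ φ y) → ∫ y, φ y = 1 → spaceAvg φ W (t, x) ≤ K' * t := by
    intro φ hφ hφc hφ0 hφ1
    have hφ2 : ContDiff ℝ 2 φ := hφ.of_le two_le_infty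
    have key : ∀ δ > 0, spaceAvg φ W (t, x) ≤ K' * t + δ * (2 * (n + 1) * t) := by
      intro δ hδ
      -- With this `R` the barrier exceeds the global bound `K` on the lateral boundary, even if
      -- `K'` is negative.
      obtain ⟨R, hR0, hR⟩ : ∃ R : ℝ, 0 < R ∧ K + |K'| * T ≤ δ * R ^ 2 := by
        have h1 : Tendsto (fun R : ℝ => δ * R ^ 2) atTop atTop :=
          (tendsto_pow_atTop (by norm_num)).const_mul_atTop hδ
        obtain ⟨R, h2, h3⟩ := ((eventually_gt_atTop 0).and
          (h1.eventually_ge_atTop (K + |K'| * T))).exists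
        exact ⟨R, h2, h3⟩
      set b : SpaceTime n → ℝ :=
        fun p => 0 + K' * p.1 + δ * (distSq x p + 2 * (n + 1) * p.1) with hbdef
      have hbs : ContDiff ℝ 2 b := contDiff_paraboloid 0 K' δ x
      have hbheat : ∀ p, heat b p = K' := heat_paraboloid 0 K' δ x
      have hMP := nonpos_of_heat_le (s := 0) (T := T) (R := R) (L := 0) (x₀ := x)
        (v := fun p => extendedAvg φ W₀ W p - b p)
        (((continuousOn_extendedAvg hT hφ hφc hW hb hini).mono
          (prod_mono subset_rfl (subset_univ _))).sub hbs.continuous.continuousOn) ?_ ?_ ?_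
        t ⟨ht.1.le, ht.2⟩ x (Metric.mem_closedBall_self hR0.le)
      · have e1 : extendedAvg φ W₀ W (t, x) = spaceAvg φ W (t, x) := by
          simp [extendedAvg, not_le.2 ht.1]
        simp only [e1, hbdef, distSq, sub_self, norm_zero] at hMP
        linarith
      · intro s hs y _ _
        have hev : (fun p => extendedAvg φ W₀ W p - b p) =ᶠ[𝓝 (s, y)]
            fun p => spaceAvg φ W p - b p := by
          have : ∀ᶠ p : SpaceTime n in 𝓝 (s, y), 0 < p.1 :=
            continuous_fst.continuousAt.eventually_mem (isOpen_Ioi.mem_nhds hs.1)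
          filter_upwards [this] with p hp
          simp [extendedAvg, not_le.2 hp]
        have hs2 : ContDiffAt ℝ 2 (spaceAvg φ W) (s, y) :=
          contDiffAt_of_slab isOpen_Ioi (contDiffOn_spaceAvg (k := 2) isOpen_Ioi hφ2 hφc hW) hs.1 y
        refine ⟨(hs2.sub hbs.contDiffAt).congr_of_eventuallyEq hev, ?_⟩
        have hcongr : heat (fun p => extendedAvg φ W₀ W p - b p) (s, y) =
            heat (fun p => spaceAvg φ W p - b p) (s, y) := by
          simp only [heat, dirDeriv_congr hev, dirDeriv_congr (dirDeriv_eventuallyEq hev _)]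
        rw [hcongr, heat_sub hs2 hbs.contDiffAt, hbheat,
          heat_spaceAvg isOpen_Ioi (hφ2.of_le (by norm_num)) hφc hW (q := (s, y)) hs.1, zero_mul, sub_nonpos]
        exact spaceAvg_le hφ.continuous hφc hφ0 hφ1 (ContDiffOn.continuousOn_heat isOpen_Ioi hW)
          (q := (s, y)) hs.1 (hheat s hs)
      · intro y _
        have e1 : extendedAvg φ W₀ W (0, y) = ∫ z, φ (z - y) * W₀ z := by simp [extendedAvg]
        have e2 : ∫ z, φ (z - y) * W₀ z ≤ 0 :=
          integral_nonpos fun z => mul_nonpos_of_nonneg_of_nonpos (hφ0 _) (h0 z)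
        simp only [e1, hbdef, distSq]
        have : 0 ≤ δ * ‖y - x‖ ^ 2 := by positivity
        linarith
      · intro s hs y hy
        have hyR : distSq x (s, y) = R ^ 2 := by
          simp only [distSq]
          rw [← dist_eq_norm, Metric.mem_sphere.1 hy]
        rcases eq_or_lt_of_le hs.1 with hs0 | hs0
        · subst hs0
          have e1 : extendedAvg φ W₀ W (0, y) = ∫ z, φ (z - y) * W₀ z := by simp [extendedAvg]
          have e2 : ∫ z, φ (z - y) * W₀ z ≤ 0 :=
            integral_nonpos fun z => mul_nonpos_of_nonneg_of_nonpos (hφ0 _) (h0 z)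
          simp only [e1, hbdef, hyR]
          have : 0 ≤ δ * R ^ 2 := by positivity
          linarith
        · have e1 : extendedAvg φ W₀ W (s, y) = spaceAvg φ W (s, y) := by
            simp [extendedAvg, not_le.2 hs0]
          have e2 : spaceAvg φ W (s, y) ≤ K :=
            spaceAvg_le hφ.continuous hφc hφ0 hφ1 hW.continuousOn (q := (s, y)) hs0
              (hK s ⟨hs0, hs.2⟩)
          simp only [e1, hbdef, hyR]
          have h3 : -(|K'| * T) ≤ K' * s := by
            have : |K' * s| ≤ |K'| * T := by
              rw [abs_mul, abs_of_pos hs0]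
              exact mul_le_mul_of_nonneg_left hs.2 (abs_nonneg _)
            linarith [neg_abs_le (K' * s)]
          have h4 : 0 ≤ δ * (2 * (n + 1) * s) := by positivity
          linarith
    have hlim : Tendsto (fun δ : ℝ => K' * t + δ * (2 * (n + 1) * t)) (𝓝[>] 0)
        (𝓝 (K' * t + 0 * (2 * (n + 1) * t))) :=
      ((tendsto_id.mul_const _).const_add _).mono_left nhdsWithin_le_nhds
    simp only [zero_mul, add_zero] at hlim
    exact ge_of_tendsto hlim (by filter_upwards [self_mem_nhdsWithin] with δ hδ using key δ hδ)
  -- The bound holds for every average; a bump supported where `W(t, ·) > c > K' t` transfers it to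
  -- the point.
  by_contra! hlt
  have hcont : Continuous fun y => W (t, y) := continuous_slice hW.continuousOn ht.1
  obtain ⟨c, hc1, hc2⟩ := exists_between hlt
  obtain ⟨h, hh, hball⟩ := Metric.isOpen_iff.1 (isOpen_Ioi.preimage hcont) x
    (show c < W (t, x) from hc2)
  let f : ContDiffBump (0 : EuclideanSpace ℝ (Fin (n + 1))) :=
    { rIn := h / 2, rOut := h, rIn_pos := by linarith, rIn_lt_rOut := by linarith }
  have hle := havg (f.normed volume) f.contDiff_normed f.hasCompactSupport_normed
    (fun y => f.nonneg_normed y) (f.integral_normed)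
  have hge : c ≤ spaceAvg (f.normed volume) W (t, x) := by
    calc c = ∫ y, f.normed volume y * c := by rw [integral_mul_const, f.integral_normed, one_mul]
      _ ≤ _ := by
        refine integral_mono ((f.continuous_normed.integrable_of_hasCompactSupport
          f.hasCompactSupport_normed).mul_const c) (integrable_mul_translate f.continuous_normed
          f.hasCompactSupport_normed hW.continuousOn (q := (t, x)) ht.1) fun y => ?_
        by_cases hy : y ∈ Function.support (f.normed volume)
        · rw [f.support_normed_eq] at hy
          have h1 : x + y ∈ Metric.ball x h := by
            simpa [f, Metric.mem_ball, dist_eq_norm] using hy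
          refine mul_le_mul_of_nonneg_left ?_ (f.nonneg_normed y)
          simpa using (hball h1).le
        · simp [Function.notMem_support.1 hy]
  linarith

end InitialLayer

/-! ### The Allen–Cahn equation in terms of the heat operator -/

section Slices

variable {n : ℕ}

theorem dirDeriv_slice {g : SpaceTime n → ℝ} {t : ℝ} {y : EuclideanSpace ℝ (Fin (n + 1))}
    (hg : DifferentiableAt ℝ g (t, y)) (v : EuclideanSpace ℝ (Fin (n + 1))) :
    dirDeriv v (fun z => g (t, z)) y = dirDeriv ((0, v) : SpaceTime n) g (t, y) := by
  have h := (hg.hasFDerivAt.comp y (hasFDerivAt_prodMk_right t y)).fderiv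
  simp only [Function.comp_def] at h
  simp [dirDeriv, h]

theorem hasDerivAt_time {g : SpaceTime n → ℝ} {t : ℝ} {y : EuclideanSpace ℝ (Fin (n + 1))}
    (hg : DifferentiableAt ℝ g (t, y)) :
    HasDerivAt (fun s => g (s, y)) (dirDeriv (timeDir n) g (t, y)) t :=
  hg.hasFDerivAt.comp_hasDerivAt t ((hasDerivAt_id t).prodMk (hasDerivAt_const t y))

theorem laplacian_slice {I : Set ℝ} (hI : IsOpen I) {g : SpaceTime n → ℝ}
    (hg : ContDiffOn ℝ 2 g (I ×ˢ univ)) {t : ℝ} (ht : t ∈ I)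
    (y : EuclideanSpace ℝ (Fin (n + 1))) :
    Laplacian.laplacian (fun z => g (t, z)) y =
      ∑ i, dirDeriv (spaceDir i) (dirDeriv (spaceDir i) g) (t, y) := by
  have hs : ∀ z, ContDiffAt ℝ 2 (fun z => g (t, z)) z := fun z =>
    (contDiffAt_of_slab hI hg ht z).comp z (by fun_prop)
  rw [congrFun (InnerProductSpace.laplacian_eq_iteratedFDeriv_orthonormalBasis _
    (EuclideanSpace.basisFun (Fin (n + 1)) ℝ)) y]
  refine Finset.sum_congr rfl fun i _ => ?_
  rw [iteratedFDeriv_two_apply]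
  have hd : DifferentiableAt ℝ (fderiv ℝ fun z => g (t, z)) y :=
    ((hs y).fderiv_right (m := 1) (by norm_num)).differentiableAt (by simp)
  set e : EuclideanSpace ℝ (Fin (n + 1)) := EuclideanSpace.single i 1
  have h1 : fderiv ℝ (fderiv ℝ fun z => g (t, z)) y e e =
      dirDeriv e (dirDeriv e fun z => g (t, z)) y := by
    have := (hd.hasFDerivAt.clm_apply (hasFDerivAt_const e y)).fderiv
    rw [dirDeriv, show dirDeriv e (fun z => g (t, z)) =
      fun q => fderiv ℝ (fun z => g (t, z)) q e from rfl, this]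
    simp
  have h2 : dirDeriv e (fun z => g (t, z)) = fun z => dirDeriv (spaceDir i) g (t, z) :=
    funext fun z => dirDeriv_slice
      ((contDiffAt_of_slab hI hg ht z).differentiableAt (by simp)) e
  have h3 : DifferentiableAt ℝ (dirDeriv (spaceDir i) g) (t, y) :=
    ((contDiffAt_of_slab hI hg ht y).dirDeriv (m := 1) (by norm_num) _).differentiableAt (by simp)
  simp only [EuclideanSpace.basisFun_apply, Matrix.cons_val_zero, Matrix.cons_val_one]
  rw [h1, h2, dirDeriv_slice h3]
  rfl

theorem norm_gradient_slice_sq {g : SpaceTime n → ℝ} {t : ℝ}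
    {y : EuclideanSpace ℝ (Fin (n + 1))} (hg : DifferentiableAt ℝ g (t, y)) :
    ‖gradient (fun z => g (t, z)) y‖ ^ 2 = gradSq g (t, y) := by
  rw [EuclideanSpace.real_norm_sq_eq, gradSq]
  refine Finset.sum_congr rfl fun i _ => ?_
  congr 1
  have h1 := dirDeriv_slice hg (EuclideanSpace.single i 1)
  rw [dirDeriv] at h1
  rw [spaceDir, ← h1, gradient]
  have h2 := InnerProductSpace.toDual_symm_apply (𝕜 := ℝ)
    (x := (EuclideanSpace.single i 1 : EuclideanSpace ℝ (Fin (n + 1))))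
    (y := fderiv ℝ (fun z => g (t, z)) y)
  rw [← h2, EuclideanSpace.inner_single_right]
  simp

end Slices

/-- A bounded smooth solution of `∂ₜ U = Δ U + L (U - U³)` attaining its initial values in the
sense of distributions. -/
structure IsReactionSolution {n : ℕ} (L : ℝ) (U₀ : EuclideanSpace ℝ (Fin (n + 1)) → ℝ)
    (U : SpaceTime n → ℝ) : Prop where
  contDiffOn : ContDiffOn ℝ ∞ U (Ioi 0 ×ˢ univ)
  heat_eq : ∀ p : SpaceTime n, 0 < p.1 → heat U p = L * (U p - U p ^ 3)
  bounded : ∀ T > 0, ∃ K : ℝ, ∀ t ∈ Ioc 0 T, ∀ x, |U (t, x)| ≤ K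
  initial : ∀ φ : EuclideanSpace ℝ (Fin (n + 1)) → ℝ, ContDiff ℝ ∞ φ → HasCompactSupport φ →
    Tendsto (fun t => ∫ x, φ x * U (t, x)) (𝓝[>] 0) (𝓝 (∫ x, φ x * U₀ x))

theorem deriv_wellPotential (v : ℝ) : deriv wellPotential v = -2 * (v - v ^ 3) := by
  have h : HasDerivAt (fun v : ℝ => (1 - v ^ 2) ^ 2 / 2) (-2 * (v - v ^ 3)) v := by
    have h1 := ((((hasDerivAt_id v).pow 2).const_sub 1).pow 2).div_const 2
    refine h1.congr_deriv ?_
    simp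
    ring
  exact h.deriv

/-- The factor `2` comes from `F'(v) = -2(v - v³)`. -/
theorem IsAllenCahnSolution.isReactionSolution {n : ℕ} {ε : ℝ}
    {u₀ : EuclideanSpace ℝ (Fin (n + 1)) → ℝ} {u : ℝ → EuclideanSpace ℝ (Fin (n + 1)) → ℝ}
    (h : IsAllenCahnSolution ε u₀ u) :
    IsReactionSolution (2 / ε ^ 2) u₀ (fun p : SpaceTime n => u p.1 p.2) where
  contDiffOn := h.smooth
  bounded := h.bounded
  initial φ hφ hφc := by simpa only [mul_comm] using h.initial φ hφ hφc
  heat_eq := by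
    rintro ⟨t, x⟩ ht
    have h2 : ContDiffOn ℝ 2 (fun p : SpaceTime n => u p.1 p.2) (Ioi 0 ×ˢ univ) :=
      h.smooth.of_le two_le_infty
    have h3 := h.equation t ht x
    have h4 := laplacian_slice isOpen_Ioi h2 ht x
    have h5 := (hasDerivAt_time ((contDiffAt_of_slab isOpen_Ioi h2 ht x).differentiableAt
      (by simp))).deriv
    simp only at h4 h5
    rw [h5, h4, deriv_wellPotential] at h3
    rw [heat, h3]
    ring

/-! ### Comparison for reaction solutions and the bound `|U| ≤ 1` -/

namespace IsReactionSolution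

variable {n : ℕ} {L : ℝ} {U₀ : EuclideanSpace ℝ (Fin (n + 1)) → ℝ} {U : SpaceTime n → ℝ}

theorem contDiffOn_two (h : IsReactionSolution L U₀ U) : ContDiffOn ℝ 2 U (Ioi 0 ×ˢ univ) :=
  h.contDiffOn.of_le two_le_infty

theorem contDiffAt (h : IsReactionSolution L U₀ U) {t : ℝ} (ht : 0 < t)
    (x : EuclideanSpace ℝ (Fin (n + 1))) (k : ℕ) : ContDiffAt ℝ k U (t, x) :=
  (contDiffAt_of_slab isOpen_Ioi h.contDiffOn ht x).of_le (by
    have : ((k : ℕ∞) : ℕ∞ω) ≤ ((⊤ : ℕ∞) : ℕ∞ω) := WithTop.coe_le_coe.2 le_top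
    exact this)

/-- The nonlinearity is odd. This exchanges the two phases and turns upper bounds into lower ones.
-/
theorem neg (h : IsReactionSolution L U₀ U) :
    IsReactionSolution L (fun x => -U₀ x) (fun p => -U p) where
  contDiffOn := h.contDiffOn.neg
  bounded T hT := by simpa only [abs_neg] using h.bounded T hT
  initial φ hφ hφc := by
    simpa only [mul_neg, integral_neg] using (h.initial φ hφ hφc).neg
  heat_eq := by
    rintro ⟨t, x⟩ ht
    have := heat_const_mul (-1) (h.contDiffAt ht x 2)
    simp only [neg_one_mul] at this
    rw [this, h.heat_eq _ ht]
    ring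

/-- A solution lies below every smooth supersolution of the heat equation that lies above its
initial values, up to an error which is linear in time. -/
theorem exists_le_add_mul (h : IsReactionSolution L U₀ U) (hL : 0 ≤ L)
    (hm : AEStronglyMeasurable U₀) (h₀ : ∀ x, |U₀ x| ≤ 1) {b : SpaceTime n → ℝ}
    (hb : ContDiff ℝ 2 b) {T B : ℝ} (hT : 0 < T)
    (hheat : ∀ t ∈ Ioc 0 T, ∀ x, 0 ≤ heat b (t, x)) (hB : ∀ t ∈ Ioc 0 T, ∀ x, B ≤ b (t, x))
    (hle : ∀ x, U₀ x ≤ b (0, x)) :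
    ∃ K, 0 ≤ K ∧ ∀ t ∈ Ioc 0 T, ∀ x, U (t, x) ≤ b (t, x) + K * t := by
  obtain ⟨K, hK⟩ := h.bounded T hT
  have hK0 : 0 ≤ K := (abs_nonneg _).trans (hK T ⟨hT, le_rfl⟩ 0)
  refine ⟨L * (K + K ^ 3), by positivity, fun t ht x => ?_⟩
  -- Before `|U| ≤ 1` is known, the reaction is only bounded by `L(K + K³)`, which becomes the rate
  -- of the linear error.
  have key := le_mul_of_heat_le (T := T) (K := K - B) (K' := L * (K + K ^ 3))
    (W := fun p => U p - b p) (W₀ := fun x => U₀ x - b (0, x))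
    (h.contDiffOn_two.sub hb.contDiffOn) ?_ ?_ ?_ ?_ ?_ t ht x
  · linarith
  · intro R
    obtain ⟨C, hC⟩ := ((isCompact_Icc (a := (0 : ℝ)) (b := T)).prod
      (isCompact_closedBall (0 : EuclideanSpace ℝ (Fin (n + 1))) R)).exists_bound_of_continuousOn
        hb.continuous.continuousOn
    refine ⟨K + C, fun t ht y hy => (abs_sub _ _).trans (add_le_add (hK t ht y) ?_)⟩
    exact hC (t, y) ⟨⟨ht.1.le, ht.2⟩, hy⟩
  · intro t ht y
    linarith [hB t ht y, (le_abs_self _).trans (hK t ht y)]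
  · intro t ht y
    rw [heat_sub (h.contDiffAt ht.1 y 2) hb.contDiffAt, h.heat_eq _ ht.1]
    have h1 : U (t, y) - U (t, y) ^ 3 ≤ K + K ^ 3 := by
      have h2 := hK t ht y
      have h3 : |U (t, y) ^ 3| ≤ K ^ 3 := by
        rw [abs_pow]
        exact pow_le_pow_left₀ (abs_nonneg _) h2 3
      linarith [le_abs_self (U (t, y)), neg_abs_le (U (t, y) ^ 3)]
    linarith [mul_le_mul_of_nonneg_left h1 hL, hheat t ht y]
  · intro y
    linarith [hle y]
  · intro ψ hψ hψc
    have hψi := hψ.continuous.integrable_of_hasCompactSupport (μ := volume) hψc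
    have h1 : Integrable fun y => ψ y * U₀ y :=
      hψi.mul_bdd hm (Eventually.of_forall h₀)
    have hbi : ∀ t, Integrable fun y => ψ y * b (t, y) := fun t =>
      (hψ.continuous.mul (hb.continuous.comp (by fun_prop))).integrable_of_hasCompactSupport
        hψc.mul_right
    have h2 : Tendsto (fun t => ∫ y, ψ y * b (t, y)) (𝓝[>] 0) (𝓝 (∫ y, ψ y * b (0, y))) :=
      (hasDerivAt_integral_mul isOpen_univ hψ.continuous hψc
        (hb.of_le (by norm_num)).contDiffOn
        (mem_univ (0 : ℝ))).continuousAt.tendsto.mono_left nhdsWithin_le_nhds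
    have h3 := (h.initial ψ hψ hψc).sub h2
    rw [← integral_sub h1 (hbi 0)] at h3
    simp only [mul_sub]
    refine h3.congr' ?_
    filter_upwards [self_mem_nhdsWithin] with t ht
    refine (integral_sub ?_ (hbi t)).symm
    exact (hψ.continuous.mul (continuous_slice h.contDiffOn.continuousOn
      (show t ∈ Ioi 0 from ht))).integrable_of_hasCompactSupport hψc.mul_right

/-- After a time `δ` the solution is at most `1 + Kδ` by the crude comparison. From then on the
reaction is nonpositive wherever `U ≥ 1`, so the maximum principle preserves the bound up to a
paraboloid that vanishes with `δ`. -/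
theorem le_one (h : IsReactionSolution L U₀ U) (hL : 0 ≤ L)
    (hm : AEStronglyMeasurable U₀) (h₀ : ∀ x, |U₀ x| ≤ 1) {T : ℝ}
    (hT : 0 < T) (x : EuclideanSpace ℝ (Fin (n + 1))) : U (T, x) ≤ 1 := by
  obtain ⟨K, hK0, hK⟩ := h.exists_le_add_mul hL hm h₀ (b := fun _ => 1) (B := 1) contDiff_const hT
    (by simp [heat_const]) (by simp) (fun x => (le_abs_self _).trans (h₀ x))
  have key : ∀ δ ∈ Ioo 0 T, U (T, x) ≤ 1 + K * δ + δ * (2 * (n + 1) * T) := by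
    intro δ hδ
    have hδ0 : 0 < δ := hδ.1
    set b : SpaceTime n → ℝ :=
      fun p => (1 + K * δ) + 0 * p.1 + δ * (distSq x p + 2 * (n + 1) * p.1) with hbdef
    have hb1 : ∀ p : SpaceTime n, 0 < p.1 → 1 + K * δ ≤ b p := by
      intro p hp
      have : 0 ≤ δ * (distSq x p + 2 * (n + 1) * p.1) := by
        have : 0 ≤ distSq x p := sq_nonneg _
        positivity
      simp only [hbdef]
      linarith
    obtain ⟨R, hR0, hR⟩ : ∃ R : ℝ, 0 < R ∧ K * T ≤ δ * R ^ 2 := by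
      have h1 : Tendsto (fun R : ℝ => δ * R ^ 2) atTop atTop :=
        (tendsto_pow_atTop (by norm_num)).const_mul_atTop hδ0
      obtain ⟨R, h2, h3⟩ := ((eventually_gt_atTop 0).and (h1.eventually_ge_atTop (K * T))).exists
      exact ⟨R, h2, h3⟩
    have hMP := nonpos_of_heat_le (s := δ) (T := T) (R := R) (L := 0) (x₀ := x)
      (v := fun p => U p - b p) ?_ ?_ ?_ ?_ T ⟨hδ.2.le, le_rfl⟩ x
      (Metric.mem_closedBall_self hR0.le)
    · simp only [hbdef, distSq, sub_self, norm_zero] at hMP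
      linarith
    · exact (h.contDiffOn.continuousOn.mono (prod_mono
        (fun t ht => hδ0.trans_le ht.1) (subset_univ _))).sub
        (contDiff_paraboloid _ _ _ x).continuous.continuousOn
    · intro t ht y _ hpos
      have ht0 : 0 < t := hδ0.trans ht.1
      have hbc := (contDiff_paraboloid (1 + K * δ) 0 δ x).contDiffAt (x := (t, y))
      refine ⟨(h.contDiffAt ht0 y 2).sub hbc, ?_⟩
      rw [heat_sub (h.contDiffAt ht0 y 2) hbc, heat_paraboloid, h.heat_eq _ ht0]
      have hU : 1 ≤ U (t, y) := by
        have := hb1 (t, y) ht0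
        have : 0 ≤ K * δ := by positivity
        linarith
      have h5 : U (t, y) - U (t, y) ^ 3 ≤ 0 := by
        linarith [le_self_pow₀ hU (n := 3) (by norm_num)]
      linarith [mul_nonpos_of_nonneg_of_nonpos hL h5]
    · intro y _
      linarith [hK δ ⟨hδ0, hδ.2.le⟩ y, hb1 (δ, y) hδ0]
    · intro t ht y hy
      have ht0 : 0 < t := hδ0.trans_le ht.1
      have hyR : distSq x (t, y) = R ^ 2 := by
        simp only [distSq]
        rw [← dist_eq_norm, Metric.mem_sphere.1 hy]
      have h6 := hK t ⟨ht0, ht.2⟩ y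
      have h7 : K * t ≤ K * T := mul_le_mul_of_nonneg_left ht.2 hK0
      have h8 : 0 ≤ K * δ := by positivity
      have h9 : 0 ≤ δ * (2 * (n + 1) * t) := by positivity
      simp only [hbdef, hyR]
      linarith
  have hlim : Tendsto (fun δ : ℝ => 1 + K * δ + δ * (2 * (n + 1) * T)) (𝓝[>] 0) (𝓝 1) := by
    have : Continuous fun δ : ℝ => 1 + K * δ + δ * (2 * (n + 1) * T) := by fun_prop
    simpa using (this.tendsto 0).mono_left (nhdsWithin_le_nhds (s := Ioi 0))
  exact ge_of_tendsto hlim (by filter_upwards [Ioo_mem_nhdsGT hT] with δ hδ using key δ hδ)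

theorem abs_le_one (h : IsReactionSolution L U₀ U) (hL : 0 ≤ L)
    (hm : AEStronglyMeasurable U₀) (h₀ : ∀ x, |U₀ x| ≤ 1) {T : ℝ}
    (hT : 0 < T) (x : EuclideanSpace ℝ (Fin (n + 1))) : |U (T, x)| ≤ 1 := by
  refine abs_le.2 ⟨?_, h.le_one hL hm h₀ hT x⟩
  have := h.neg.le_one hL hm.neg (by simpa using h₀) hT x
  linarith

end IsReactionSolution

/-! ### Decay away from the interface -/

section Barrier

variable {n : ℕ}

theorem heat_time_mul {φ : ℝ → ℝ} (hφ : ContDiff ℝ 2 φ) {f : SpaceTime n → ℝ} {p : SpaceTime n}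
    (hf : ContDiffAt ℝ 2 f p) :
    heat (fun q => φ q.1 * f q) p = φ p.1 * heat f p + deriv φ p.1 * f p := by
  have hφ' : ContDiffAt ℝ 2 (fun q : SpaceTime n => φ q.1) p :=
    (hφ.comp contDiff_fst).contDiffAt
  rw [heat_mul (f := fun q : SpaceTime n => φ q.1) hφ' hf, heat_time (hφ.differentiable (by simp))]
  simp [dirDeriv_spaceDir_time _ _ _ (hφ.differentiable (by simp))]

/-- The cross term `-4χP ∇χ·∇P` is absorbed by the good term `-2|∇(χP)|²`. The constant `6` is what
completing the square leaves: the defect is exactly `-2|χ∇P + 2P∇χ|²`. -/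
theorem heat_sq_mul_le {χ P : SpaceTime n → ℝ} {p : SpaceTime n} (hχ : ContDiffAt ℝ 2 χ p)
    (hP : ContDiffAt ℝ 2 P p) :
    heat (fun q => (χ q * P q) ^ 2) p ≤ 2 * χ p ^ 2 * (P p * heat P p) +
      P p ^ 2 * (2 * χ p * heat χ p + 6 * gradSq χ p) := by
  have h1 : gradSq (fun q => χ q * P q) p = ∑ i, (χ p * dirDeriv (spaceDir i) P p +
      dirDeriv (spaceDir i) χ p * P p) ^ 2 := by
    simp only [gradSq, dirDeriv_mul (hχ.differentiableAt (by simp)) (hP.differentiableAt (by simp))]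
  rw [heat_sq (f := fun q => χ q * P q) (hχ.mul hP), heat_mul hχ hP, h1, gradSq]
  have h2 : -(4 * (χ p * P p)) * ∑ i, dirDeriv (spaceDir i) χ p * dirDeriv (spaceDir i) P p -
      2 * ∑ i, (χ p * dirDeriv (spaceDir i) P p + dirDeriv (spaceDir i) χ p * P p) ^ 2 ≤
      6 * P p ^ 2 * ∑ i, dirDeriv (spaceDir i) χ p ^ 2 := by
    simp only [Finset.mul_sum, ← Finset.sum_sub_distrib]
    refine Finset.sum_le_sum fun i _ => ?_
    linarith [sq_nonneg (χ p * dirDeriv (spaceDir i) P p + 2 * (P p * dirDeriv (spaceDir i) χ p))]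
  linarith

/-- A supersolution of the heat equation which is large away from `x`. -/
noncomputable def decayBarrier (x : EuclideanSpace ℝ (Fin (n + 1))) (T D : ℝ)
    (p : SpaceTime n) : ℝ :=
  (D⁻¹ * (distSq x p + 6 * (n + 1) * (p.1 + T))) ^ (n + 2)

theorem contDiff_decayBarrier (x : EuclideanSpace ℝ (Fin (n + 1))) (T D : ℝ) :
    ContDiff ℝ 2 (decayBarrier x T D) := by
  have := contDiff_distSq (k := 2) x
  unfold decayBarrier
  fun_prop

/-- For the base `g` of the power, `heat g = 4(n+1)/D` and `|∇g|² = 4 distSq/D²`. In the chain rule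
for `g^(n+2)` these combine to a positive multiple of `g^n (g - distSq/D)`, which is nonnegative;
the coefficient `6(n+1)` is chosen to make them match. -/
theorem heat_decayBarrier_nonneg (x : EuclideanSpace ℝ (Fin (n + 1))) {T D : ℝ} (hD : 0 < D)
    {p : SpaceTime n} (hp : 0 ≤ p.1 + T) : 0 ≤ heat (decayBarrier x T D) p := by
  have hd := (contDiff_distSq (k := 2) x).contDiffAt (x := p)
  have ht : ContDiffAt ℝ 2 (fun q : SpaceTime n => 6 * ((n : ℝ) + 1) * (q.1 + T)) p := by fun_prop
  have hg : ContDiffAt ℝ 2 (fun q : SpaceTime n => distSq x q + 6 * ((n : ℝ) + 1) * (q.1 + T)) p :=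
    hd.add ht
  have hheat : heat (fun q : SpaceTime n => D⁻¹ * (distSq x q + 6 * ((n : ℝ) + 1) * (q.1 + T))) p =
      D⁻¹ * (4 * (n + 1)) := by
    rw [heat_const_mul _ hg, heat_add hd ht, heat_distSq,
      heat_time (φ := fun r => 6 * ((n : ℝ) + 1) * (r + T)) (by fun_prop),
      show deriv (fun r => 6 * ((n : ℝ) + 1) * (r + T)) p.1 = 6 * (n + 1) by simp]
    ring
  have hgrad : gradSq (fun q : SpaceTime n => D⁻¹ * (distSq x q + 6 * ((n : ℝ) + 1) * (q.1 + T))) p =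
      D⁻¹ ^ 2 * (4 * distSq x p) := by
    rw [← gradSq_distSq, gradSq, gradSq, Finset.mul_sum]
    refine Finset.sum_congr rfl fun i _ => ?_
    rw [dirDeriv_mul (differentiableAt_const _) (hg.differentiableAt (by simp)), dirDeriv_const,
      dirDeriv_add (hd.differentiableAt (by simp)) (ht.differentiableAt (by simp)),
      dirDeriv_spaceDir_time (fun r => 6 * ((n : ℝ) + 1) * (r + T)) i p (by fun_prop)]
    ring
  have hderiv : ∀ m : ℕ, deriv (fun r : ℝ => r ^ (m + 1)) = fun r : ℝ => ((m : ℝ) + 1) * r ^ m := by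
    intro m
    ext r
    simp
  have hcomp := heat_comp (φ := fun r : ℝ => r ^ (n + 2)) (p := p) (contDiff_id.pow _)
    (contDiffAt_const.mul hg : ContDiffAt ℝ 2
      (fun q : SpaceTime n => D⁻¹ * (distSq x q + 6 * ((n : ℝ) + 1) * (q.1 + T))) p)
  rw [hheat, hgrad, hderiv (n + 1), deriv_const_mul _ (by fun_prop), hderiv n] at hcomp
  have h0 : 0 ≤ distSq x p := sq_nonneg _
  have h1 : 0 ≤ 6 * ((n : ℝ) + 1) * (p.1 + T) := by positivity
  set q := D⁻¹ * (distSq x p + 6 * ((n : ℝ) + 1) * (p.1 + T)) with hq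
  have hq0 : 0 ≤ q := by positivity
  have hq1 : D⁻¹ * distSq x p ≤ q := mul_le_mul_of_nonneg_left (by linarith) (by positivity)
  have : heat (decayBarrier x T D) p = ((n : ℝ) + 2) * (n + 1) * 4 * D⁻¹ * q ^ n *
      (q - D⁻¹ * distSq x p) := by
    refine (show heat (decayBarrier x T D) p = _ from hcomp).trans ?_
    push_cast
    ring
  rw [this]
  have := sub_nonneg.2 hq1
  positivity

end Barrier

/-! ### The Bernstein estimate -/

namespace IsReactionSolution

variable {n : ℕ} {L : ℝ} {U₀ : EuclideanSpace ℝ (Fin (n + 1)) → ℝ} {U : SpaceTime n → ℝ}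

theorem heat_dirDeriv_eq (h : IsReactionSolution L U₀ U) {t : ℝ} (ht : 0 < t)
    (x : EuclideanSpace ℝ (Fin (n + 1))) (v : SpaceTime n) :
    heat (dirDeriv v U) (t, x) = L * (1 - 3 * U (t, x) ^ 2) * dirDeriv v U (t, x) := by
  rw [heat_dirDeriv (h.contDiffAt ht x 3)]
  have hev : heat U =ᶠ[𝓝 (t, x)] fun p => (fun r => L * (r - r ^ 3)) (U p) := by
    have : ∀ᶠ p : SpaceTime n in 𝓝 (t, x), 0 < p.1 :=
      continuous_fst.continuousAt.eventually_mem (isOpen_Ioi.mem_nhds ht)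
    filter_upwards [this] with p hp using h.heat_eq p hp
  have hd : HasDerivAt (fun r : ℝ => L * (r - r ^ 3)) (L * (1 - 3 * U (t, x) ^ 2)) (U (t, x)) := by
    simpa using (((hasDerivAt_id (U (t, x))).sub ((hasDerivAt_id (U (t, x))).pow 3)).const_mul L)
  rw [dirDeriv_congr hev, dirDeriv_comp hd.differentiableAt
    ((h.contDiffAt ht x 1).differentiableAt (by simp)), hd.deriv]

/-- A localised Bernstein quantity is a subsolution of a linear parabolic equation. -/
theorem heat_bernstein_le (h : IsReactionSolution L U₀ U) (hL : 0 ≤ L) {s T R : ℝ} (hR0 : 0 < R) (hR : T * (4 * n + 28) ≤ R ^ 2) (hs : 0 ≤ s)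
    (x₀ : EuclideanSpace ℝ (Fin (n + 1))) (i : Fin (n + 1)) {t : ℝ} (ht : t ∈ Ioc s T)
    {y : EuclideanSpace ℝ (Fin (n + 1))} (hy : y ∈ Metric.ball x₀ R)
    {Q : SpaceTime n → ℝ} (hQ : Q = fun p => (p.1 - s) *
      ((1 - (R ^ 2)⁻¹ * distSq x₀ p) * dirDeriv (spaceDir i) U p) ^ 2 + (1 + U p) ^ 2) :
    ContDiffAt ℝ 2 Q (t, y) ∧ heat Q (t, y) ≤ 2 * L * Q (t, y) := by
  have ht0 : 0 < t := hs.trans_lt ht.1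
  set χ : SpaceTime n → ℝ := fun p => 1 - (R ^ 2)⁻¹ * distSq x₀ p with hχdef
  set P : SpaceTime n → ℝ := dirDeriv (spaceDir i) U with hPdef
  have hdist := contDiff_distSq (k := 2) x₀
  have hχs : ContDiffAt ℝ 2 χ (t, y) := (contDiff_const.sub (contDiff_const.mul hdist)).contDiffAt
  have hPs : ContDiffAt ℝ 2 P (t, y) := (h.contDiffAt ht0 y 3).dirDeriv (by norm_num) _
  have hUs : ContDiffAt ℝ 2 U (t, y) := h.contDiffAt ht0 y 2
  have hZ : ContDiffAt ℝ 2 (fun p => (χ p * P p) ^ 2) (t, y) := (hχs.mul hPs).pow 2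
  have hw : ContDiffAt ℝ 2 (fun p => 1 + U p) (t, y) := contDiffAt_const.add hUs
  have htime : ContDiffAt ℝ 2 (fun p : SpaceTime n => p.1 - s) (t, y) := by fun_prop
  have hT : 0 < T := ht0.trans_le ht.2
  have hr : distSq x₀ (t, y) ≤ R ^ 2 := by
    simp only [distSq]
    rw [← dist_eq_norm]
    exact pow_le_pow_left₀ dist_nonneg (Metric.mem_ball.1 hy).le 2
  have hr0 : 0 ≤ distSq x₀ (t, y) := sq_nonneg _
  have hRi : 0 < (R ^ 2)⁻¹ := by positivity
  have hr1 : (R ^ 2)⁻¹ * distSq x₀ (t, y) ≤ 1 := by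
    rw [inv_mul_le_iff₀ (by positivity)]; simpa using hr
  have hχ0 : 0 ≤ χ (t, y) := by simp only [hχdef]; linarith
  have hχ1 : χ (t, y) ≤ 1 := by
    have : 0 ≤ (R ^ 2)⁻¹ * distSq x₀ (t, y) := by positivity
    simp only [hχdef]; linarith
  have hχheat : heat χ (t, y) = (R ^ 2)⁻¹ * (2 * (n + 1)) := by
    rw [hχdef, heat_sub contDiffAt_const (contDiffAt_const.mul hdist.contDiffAt), heat_const,
      heat_const_mul _ hdist.contDiffAt, heat_distSq]
    ring
  have hχgrad : gradSq χ (t, y) = (R ^ 2)⁻¹ * (4 * ((R ^ 2)⁻¹ * distSq x₀ (t, y))) := by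
    have e : ∀ j : Fin (n + 1), dirDeriv (spaceDir j) χ (t, y) =
        -(R ^ 2)⁻¹ * dirDeriv (spaceDir j) (distSq x₀) (t, y) := by
      intro j
      have := dirDeriv_comp (φ := fun r => 1 - (R ^ 2)⁻¹ * r) (f := distSq x₀) (p := (t, y))
        (by fun_prop) (hdist.differentiable (by simp) _) (spaceDir j)
      rw [hχdef, this]
      simp
    have := gradSq_distSq x₀ (t, y)
    simp only [gradSq] at this
    simp only [gradSq, e, mul_pow, ← Finset.mul_sum, this]
    ring
  have hZle := heat_sq_mul_le hχs hPs
  have e1 : P (t, y) * heat P (t, y) = L * (1 - 3 * U (t, y) ^ 2) * P (t, y) ^ 2 := by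
    rw [hPdef, h.heat_dirDeriv_eq ht0]; ring
  rw [e1, hχheat, hχgrad] at hZle
  have hP2 : 0 ≤ P (t, y) ^ 2 := sq_nonneg _
  have hZle2 : heat (fun p => (χ p * P p) ^ 2) (t, y) ≤
      2 * L * (χ (t, y) * P (t, y)) ^ 2 + P (t, y) ^ 2 * ((R ^ 2)⁻¹ * (4 * n + 28)) := by
    refine hZle.trans (add_le_add ?_ (mul_le_mul_of_nonneg_left ?_ hP2))
    · have : 0 ≤ L * (U (t, y) ^ 2 * (χ (t, y) ^ 2 * P (t, y) ^ 2)) := by positivity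
      linarith
    · have h1 : 2 * χ (t, y) * ((R ^ 2)⁻¹ * (2 * (n + 1))) ≤ 2 * 1 * ((R ^ 2)⁻¹ * (2 * (n + 1))) := by
        gcongr
      have h2 : 6 * ((R ^ 2)⁻¹ * (4 * ((R ^ 2)⁻¹ * distSq x₀ (t, y)))) ≤
          6 * ((R ^ 2)⁻¹ * (4 * 1)) := by gcongr
      linarith
  have hwheat : heat (fun p => (1 + U p) ^ 2) (t, y) ≤
      2 * L * (1 + U (t, y)) ^ 2 - 2 * P (t, y) ^ 2 := by
    have e2 : heat (fun p => 1 + U p) (t, y) = L * (U (t, y) - U (t, y) ^ 3) := by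
      rw [heat_add contDiffAt_const hUs, heat_const, h.heat_eq _ ht0, zero_add]
    have e3 : gradSq (fun p => 1 + U p) (t, y) = gradSq U (t, y) := by
      simp only [gradSq]
      refine Finset.sum_congr rfl fun j _ => ?_
      rw [dirDeriv_add (differentiableAt_const _) (hUs.differentiableAt (by simp)), dirDeriv_const,
        zero_add]
    have e4 : P (t, y) ^ 2 ≤ gradSq U (t, y) :=
      Finset.single_le_sum (f := fun j => dirDeriv (spaceDir j) U (t, y) ^ 2)
        (fun j _ => sq_nonneg _) (Finset.mem_univ i)
    rw [heat_sq hw, e2, e3]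
    -- Since `(1 + U)(U - U³) = (1 + U)²(1 - (1 - U + U²))`, this bounds the reaction contribution
    -- by `2L(1 + U)²`.
    have e5 : 0 ≤ L * ((1 + U (t, y)) ^ 2 * (1 - U (t, y) + U (t, y) ^ 2)) := by
      have : 0 ≤ 1 - U (t, y) + U (t, y) ^ 2 := by nlinarith [sq_nonneg (U (t, y) - 1 / 2)]
      positivity
    linarith
  refine ⟨hQ ▸ (htime.mul hZ).add (hw.pow 2), ?_⟩
  have hQheat : heat Q (t, y) = (t - s) * heat (fun p => (χ p * P p) ^ 2) (t, y) +
      (χ (t, y) * P (t, y)) ^ 2 + heat (fun p => (1 + U p) ^ 2) (t, y) := by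
    have := heat_time_mul (φ := fun r => r - s) (by fun_prop) hZ
    rw [hQ, heat_add (htime.mul hZ) (hw.pow 2), this]
    simp
  -- The term `-2P²` produced by `(1 + U)²` pays for two errors of size at most `P²`: the one from
  -- differentiating the factor `t - s` (`h2`) and the one from the cutoff (`h3`). The latter is
  -- where `T(4n + 28) ≤ R²` enters, with `4n + 28 = 4(n+1) + 24`.
  have hts : 0 ≤ t - s := by linarith [ht.1]
  have h1 := mul_le_mul_of_nonneg_left hZle2 hts
  have h2 : (χ (t, y) * P (t, y)) ^ 2 ≤ P (t, y) ^ 2 := by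
    rw [mul_pow]
    exact mul_le_of_le_one_left hP2 (pow_le_one₀ hχ0 hχ1)
  have h3 : (t - s) * (P (t, y) ^ 2 * ((R ^ 2)⁻¹ * (4 * n + 28))) ≤ P (t, y) ^ 2 := by
    have : (t - s) * ((R ^ 2)⁻¹ * (4 * n + 28)) ≤ 1 := by
      rw [← mul_assoc, mul_comm _ (R ^ 2)⁻¹, mul_assoc, inv_mul_le_iff₀ (by positivity), mul_one]
      refine le_trans ?_ hR
      gcongr
      linarith [ht.2]
    calc _ = P (t, y) ^ 2 * ((t - s) * ((R ^ 2)⁻¹ * (4 * n + 28))) := by ring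
      _ ≤ P (t, y) ^ 2 * 1 := mul_le_mul_of_nonneg_left this hP2
      _ = _ := mul_one _
  have hQval : Q (t, y) = (t - s) * (χ (t, y) * P (t, y)) ^ 2 + (1 + U (t, y)) ^ 2 := by rw [hQ]
  rw [hQheat, hQval]
  linarith

/-- The Bernstein quantity, started at time `s > 0`, is compared with `exp(2L(t - s))(4b + 2Ks)`,
where `b` is the decay barrier; then `s → 0`. The value of `D` makes `b ≥ 1` outside the ball of
radius `d` from time `0` on. The decay in `d` comes from `b`, not from the cutoff, whose radius `R`
is auxiliary. -/
theorem bernstein_decay (h : IsReactionSolution L U₀ U) (hL : 0 ≤ L)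
    (hm : AEStronglyMeasurable U₀) (h₀ : ∀ x, |U₀ x| ≤ 1) {T d : ℝ} (hT : 0 < T) (hd : 0 ≤ d)
    {x₀ : EuclideanSpace ℝ (Fin (n + 1))} (hneg : ∀ y ∈ Metric.ball x₀ d, U₀ y = -1)
    (i : Fin (n + 1)) :
    T * dirDeriv (spaceDir i) U (T, x₀) ^ 2 + (1 + U (T, x₀)) ^ 2 ≤
      Real.exp (2 * L * T) *
        (4 * (12 * (n + 1) * T / (d ^ 2 + 6 * (n + 1) * T)) ^ (n + 2)) := by
  have hU : ∀ t > 0, ∀ x, |U (t, x)| ≤ 1 := fun t ht x => h.abs_le_one hL hm h₀ ht x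
  set D : ℝ := d ^ 2 + 6 * (n + 1) * T with hDdef
  have hD : 0 < D := by positivity
  set b := decayBarrier x₀ T D with hbdef
  have hbs : ContDiff ℝ 2 b := contDiff_decayBarrier x₀ T D
  have hb0 : ∀ t ≥ 0, ∀ y, 0 ≤ b (t, y) := by
    intro t ht y
    have : 0 ≤ distSq x₀ (t, y) := sq_nonneg _
    simp only [hbdef, decayBarrier]
    positivity
  have hb1 : ∀ t ≥ 0, ∀ y, d ≤ dist y x₀ → 1 ≤ b (t, y) := by
    intro t ht y hy
    have h1 : d ^ 2 ≤ distSq x₀ (t, y) := by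
      simp only [distSq]
      rw [← dist_eq_norm]
      exact pow_le_pow_left₀ hd hy 2
    refine one_le_pow₀ ?_
    rw [inv_mul_eq_div, one_le_div hD, hDdef]
    have : 0 ≤ 6 * ((n : ℝ) + 1) * t := by positivity
    linarith
  -- The function `-1 + 2b` lies above `U₀`: inside the ball because `b ≥ 0`, outside because `b ≥
  -- 1`.
  obtain ⟨K, hK0, hK⟩ := h.exists_le_add_mul hL hm h₀ (b := fun p => -1 + 2 * b p) (B := -1)
    (contDiff_const.add (contDiff_const.mul hbs)) hT
    (fun t ht x => by
      rw [heat_add contDiffAt_const (contDiffAt_const.mul hbs.contDiffAt), heat_const,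
        heat_const_mul _ hbs.contDiffAt]
      have := heat_decayBarrier_nonneg x₀ hD (p := (t, x)) (T := T) (by
        have := ht.1
        simp only
        linarith)
      linarith)
    (fun t ht x => by linarith [hb0 t ht.1.le x])
    (fun x => by
      by_cases hx : x ∈ Metric.ball x₀ d
      · rw [hneg x hx]
        linarith [hb0 0 le_rfl x]
      · have := hb1 0 le_rfl x (by simpa using hx)
        linarith [(le_abs_self _).trans (h₀ x)])
  obtain ⟨R, hR0, hR1, hR2⟩ : ∃ R : ℝ, 0 < R ∧ T * (4 * n + 28) ≤ R ^ 2 ∧ d ≤ R := by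
    have h1 : Tendsto (fun R : ℝ => R ^ 2) atTop atTop := tendsto_pow_atTop (by norm_num)
    obtain ⟨R, h2, h3, h4⟩ := ((eventually_gt_atTop 0).and
      ((h1.eventually_ge_atTop (T * (4 * n + 28))).and (eventually_ge_atTop d))).exists
    exact ⟨R, h2, h3, h4⟩
  have key : ∀ s ∈ Ioo 0 T, (T - s) * dirDeriv (spaceDir i) U (T, x₀) ^ 2 + (1 + U (T, x₀)) ^ 2 ≤
      Real.exp (2 * L * (T - s)) * (4 * b (T, x₀) + 2 * K * s) := by
    intro s hs
    have hs0 : 0 < s := hs.1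
    set Q : SpaceTime n → ℝ := fun p => (p.1 - s) *
      ((1 - (R ^ 2)⁻¹ * distSq x₀ p) * dirDeriv (spaceDir i) U p) ^ 2 + (1 + U p) ^ 2 with hQdef
    have hfs : ContDiff ℝ 2 (fun p => 4 * b p + 2 * K * s) :=
      (contDiff_const.mul hbs).add contDiff_const
    have hes : ContDiff ℝ 2 fun r : ℝ => Real.exp (2 * L * (r - s)) := by fun_prop
    have hBs : ContDiff ℝ 2 fun p : SpaceTime n =>
        Real.exp (2 * L * (p.1 - s)) * (4 * b p + 2 * K * s) :=
      (hes.comp contDiff_fst).mul hfs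
    have hP : ContinuousOn (dirDeriv (spaceDir i) U) (Ioi 0 ×ˢ univ) :=
      (ContDiffOn.dirDeriv_slab (m := 1) isOpen_Ioi h.contDiffOn_two (by norm_num) _).continuousOn
    have hMP := nonpos_of_heat_le (s := s) (T := T) (R := R) (L := 2 * L) (x₀ := x₀)
      (v := fun p => Q p - Real.exp (2 * L * (p.1 - s)) * (4 * b p + 2 * K * s)) ?_ ?_ ?_ ?_ T
      ⟨hs.2.le, le_rfl⟩ x₀ (Metric.mem_closedBall_self hR0.le)
    · have : distSq x₀ (T, x₀) = 0 := by simp [distSq]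
      simp only [hQdef, this, mul_zero, sub_zero, one_mul] at hMP
      linarith
    · have hd2 := (contDiff_distSq (n := n) (k := 2) x₀).continuous
      have hcont : ContinuousOn Q (Ioi 0 ×ˢ univ) := by
        have hUc := h.contDiffOn.continuousOn
        fun_prop
      exact (hcont.mono (prod_mono (fun t ht => hs0.trans_le ht.1) (subset_univ _))).sub
        hBs.continuous.continuousOn
    · intro t ht y hy _
      obtain ⟨hQs, hQle⟩ := h.heat_bernstein_le hL hR0 hR1 hs0.le x₀ i ht hy hQdef
      refine ⟨hQs.sub hBs.contDiffAt, ?_⟩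
      rw [heat_sub hQs hBs.contDiffAt,
        heat_time_mul (φ := fun r => Real.exp (2 * L * (r - s))) hes hfs.contDiffAt,
        heat_add (contDiffAt_const.mul hbs.contDiffAt) contDiffAt_const, heat_const,
        heat_const_mul _ hbs.contDiffAt]
      have e1 : deriv (fun r => Real.exp (2 * L * (r - s))) t =
          2 * L * Real.exp (2 * L * (t - s)) := by
        have : HasDerivAt (fun r => Real.exp (2 * L * (r - s)))
          (Real.exp (2 * L * (t - s)) * (2 * L * 1)) t :=
          (((hasDerivAt_id t).sub_const s).const_mul (2 * L)).exp
        rw [this.deriv]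
        ring
      have e2 := heat_decayBarrier_nonneg x₀ hD (p := (t, y)) (T := T) (by
        have := ht.1
        simp only
        linarith)
      have e3 : 0 ≤ Real.exp (2 * L * (t - s)) * (4 * heat b (t, y)) := by positivity
      simp only [e1]
      linarith
    -- At time `s` only `(1 + U)²` remains, and `(1 + U)² ≤ 2(1 + U) ≤ 4b + 2Ks` by `|U| ≤ 1`.
    · intro y _
      have h1 := hK s ⟨hs0, hs.2.le⟩ y
      have h2 := abs_le.1 (hU s hs0 y)
      simp only [hQdef, sub_self, zero_mul, mul_zero, Real.exp_zero, one_mul, zero_add]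
      nlinarith
    -- On the lateral boundary the cutoff vanishes, and `(1 + U)² ≤ 4 ≤ 4b` because `R ≥ d`.
    · intro t ht y hy
      have ht0 : 0 < t := hs0.trans_le ht.1
      have h1 := hb1 t ht0.le y (by rw [Metric.mem_sphere.1 hy]; exact hR2)
      have h2 := abs_le.1 (hU t ht0 y)
      have hyR : distSq x₀ (t, y) = R ^ 2 := by
        simp only [distSq]
        rw [← dist_eq_norm, Metric.mem_sphere.1 hy]
      have h3 : 1 ≤ Real.exp (2 * L * (t - s)) :=
        Real.one_le_exp (mul_nonneg (by positivity) (by linarith [ht.1]))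
      have h4 : 4 ≤ 4 * b (t, y) + 2 * K * s := by
        have : 0 ≤ 2 * K * s := by positivity
        linarith
      have h5 : 1 * 4 ≤ Real.exp (2 * L * (t - s)) * (4 * b (t, y) + 2 * K * s) :=
        mul_le_mul h3 h4 (by norm_num) (by positivity)
      have h6 : (R ^ 2)⁻¹ * R ^ 2 = 1 := inv_mul_cancel₀ (by positivity)
      simp only [hQdef, hyR, h6, sub_self, zero_mul]
      nlinarith
  have e1 : b (T, x₀) = (12 * (n + 1) * T / D) ^ (n + 2) := by
    simp only [hbdef, decayBarrier, distSq, sub_self, norm_zero]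
    congr 1
    field_simp
    ring
  rw [← e1]
  have hl : Tendsto (fun s => (T - s) * dirDeriv (spaceDir i) U (T, x₀) ^ 2 + (1 + U (T, x₀)) ^ 2)
      (𝓝[>] 0) (𝓝 (T * dirDeriv (spaceDir i) U (T, x₀) ^ 2 + (1 + U (T, x₀)) ^ 2)) := by
    have : Continuous fun s =>
      (T - s) * dirDeriv (spaceDir i) U (T, x₀) ^ 2 + (1 + U (T, x₀)) ^ 2 := by fun_prop
    simpa using (this.tendsto 0).mono_left (nhdsWithin_le_nhds (s := Ioi 0))
  have hr : Tendsto (fun s => Real.exp (2 * L * (T - s)) * (4 * b (T, x₀) + 2 * K * s))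
      (𝓝[>] 0) (𝓝 (Real.exp (2 * L * T) * (4 * b (T, x₀)))) := by
    have : Continuous fun s => Real.exp (2 * L * (T - s)) * (4 * b (T, x₀) + 2 * K * s) := by
      fun_prop
    simpa using (this.tendsto 0).mono_left (nhdsWithin_le_nhds (s := Ioi 0))
  exact le_of_tendsto_of_tendsto hl hr
    (by filter_upwards [Ioo_mem_nhdsGT hT] with s hs using key s hs)

end IsReactionSolution

/-! ### Coverings of the interface -/

section Covering

variable {n : ℕ}

/-- The balls of radius `γ/2` about the points are disjoint, and each carries `ℋⁿ`-measure at least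
`θ(γ/2)ⁿ` of `M`. -/
theorem card_le_of_separated {A : ℝ≥0} {δ θ γ : ℝ} {M : Set (EuclideanSpace ℝ (Fin (n + 1)))}
    (hM : IsClosed M) (hdens : HasLowerDensityBound (n : ℝ) δ θ M) (hθ : 0 < θ)
    (hA : μH[(n : ℝ)] M ≤ (A : ℝ≥0∞)) (hγ : γ ∈ Ioc 0 δ)
    {S : Finset (EuclideanSpace ℝ (Fin (n + 1)))} (hSM : ∀ p ∈ S, p ∈ M)
    (hS : ∀ p ∈ S, ∀ q ∈ S, p ≠ q → γ ≤ dist p q) : (S.card : ℝ) ≤ A * 2 ^ n / (θ * γ ^ n) := by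
  have hγ0 : 0 < γ := hγ.1
  have hdisj : (S : Set (EuclideanSpace ℝ (Fin (n + 1)))).PairwiseDisjoint
      fun p => M ∩ Metric.ball p (γ / 2) := by
    intro p hp q hq hpq
    refine Disjoint.mono inter_subset_right inter_subset_right (Metric.ball_disjoint_ball ?_)
    linarith [hS p hp q hq hpq]
  have h1 : ∑ _p ∈ S, ENNReal.ofReal (θ * (γ / 2) ^ n) ≤ (A : ℝ≥0∞) := by
    calc ∑ _p ∈ S, ENNReal.ofReal (θ * (γ / 2) ^ n)
        ≤ ∑ p ∈ S, μH[(n : ℝ)] (M ∩ Metric.ball p (γ / 2)) := by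
          refine Finset.sum_le_sum fun p hp => ?_
          have := hdens p (hSM p hp) (γ / 2) ⟨by linarith, by linarith [hγ.2]⟩
          rwa [Real.rpow_natCast] at this
      _ = μH[(n : ℝ)] (⋃ p ∈ S, M ∩ Metric.ball p (γ / 2)) :=
          (measure_biUnion_finset hdisj fun p _ => hM.measurableSet.inter measurableSet_ball).symm
      _ ≤ μH[(n : ℝ)] M := measure_mono (iUnion₂_subset fun _ _ => inter_subset_left)
      _ ≤ A := hA
  rw [Finset.sum_const, nsmul_eq_mul, ← ENNReal.ofReal_natCast, ← ENNReal.ofReal_mul (by positivity),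
    ← ENNReal.ofReal_coe_nnreal, ENNReal.ofReal_le_ofReal_iff A.coe_nonneg] at h1
  rw [le_div_iff₀ (by positivity)]
  calc (S.card : ℝ) * (θ * γ ^ n) = S.card * (θ * (γ / 2) ^ n) * 2 ^ n := by
        rw [div_pow]; field_simp
    _ ≤ A * 2 ^ n := by gcongr

/-- A separated subset of `M` of largest cardinality is a `γ`-net; the packing bound guarantees that
a largest one exists. -/
theorem exists_finite_cover {A : ℝ≥0} {δ θ γ : ℝ} {M : Set (EuclideanSpace ℝ (Fin (n + 1)))}
    (hM : IsClosed M) (hdens : HasLowerDensityBound (n : ℝ) δ θ M) (hθ : 0 < θ)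
    (hA : μH[(n : ℝ)] M ≤ (A : ℝ≥0∞)) (hγ : γ ∈ Ioc 0 δ) :
    ∃ S : Finset (EuclideanSpace ℝ (Fin (n + 1))), (S.card : ℝ) ≤ A * 2 ^ n / (θ * γ ^ n) ∧
      ∀ q ∈ M, ∃ p ∈ S, dist q p ≤ γ := by
  classical
  set P : ℕ → Prop := fun k => ∃ S : Finset (EuclideanSpace ℝ (Fin (n + 1))), S.card = k ∧
    (∀ p ∈ S, p ∈ M) ∧ ∀ p ∈ S, ∀ q ∈ S, p ≠ q → γ ≤ dist p q with hP
  have hbound : ∀ k, P k → k ≤ ⌊A * 2 ^ n / (θ * γ ^ n)⌋₊ := by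
    rintro k ⟨S, rfl, h1, h2⟩
    exact Nat.le_floor (card_le_of_separated hM hdens hθ hA hγ h1 h2)
  have h0 : P 0 := ⟨∅, by simp⟩
  have hmax := Nat.findGreatest_spec (P := P) (Nat.zero_le ⌊A * 2 ^ n / (θ * γ ^ n)⌋₊) h0
  obtain ⟨S, hcard, hSM, hsep⟩ := hmax
  refine ⟨S, card_le_of_separated hM hdens hθ hA hγ hSM hsep, fun q hq => ?_⟩
  by_contra! hfar
  have hqS : q ∉ S := fun hmem => by
    have := hfar q hmem
    rw [dist_self] at this
    linarith [hγ.1]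
  have hP' : P (S.card + 1) := by
    refine ⟨insert q S, Finset.card_insert_of_notMem hqS, ?_, ?_⟩
    · intro p hp
      rcases Finset.mem_insert.1 hp with rfl | hp
      exacts [hq, hSM p hp]
    · intro p hp p' hp' hne
      rcases Finset.mem_insert.1 hp with h1 | h1 <;> rcases Finset.mem_insert.1 hp' with h2 | h2
      · exact absurd (h1.trans h2.symm) hne
      · exact h1 ▸ (hfar p' h2).le
      · rw [dist_comm]; exact h2 ▸ (hfar p h1).le
      · exact hsep p h1 p' h2 hne
  have := Nat.le_findGreatest (P := P) (hbound _ hP') hP'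
  omega

/-- An integrable radial profile. -/
noncomputable def decayProfile (x : EuclideanSpace ℝ (Fin (n + 1))) : ℝ :=
  ((1 + ‖x‖) ^ (2 * (n + 2)))⁻¹

theorem decayProfile_nonneg (x : EuclideanSpace ℝ (Fin (n + 1))) : 0 ≤ decayProfile x := by
  unfold decayProfile
  positivity

theorem integrable_decayProfile :
    Integrable (decayProfile : EuclideanSpace ℝ (Fin (n + 1)) → ℝ) := by
  have h := integrable_one_add_norm (E := EuclideanSpace ℝ (Fin (n + 1))) (μ := volume)
    (r := ((2 * (n + 2) : ℕ) : ℝ)) (by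
      rw [finrank_euclideanSpace_fin]
      exact_mod_cast (by omega : n + 1 < 2 * (n + 2)))
  refine h.congr (Eventually.of_forall fun x => ?_)
  simp only [decayProfile]
  rw [Real.rpow_neg (by positivity), Real.rpow_natCast]

theorem integrable_decayProfile_scaled {r : ℝ} (hr : 0 < r) (p : EuclideanSpace ℝ (Fin (n + 1))) :
    Integrable fun x => decayProfile (r⁻¹ • (x - p)) :=
  (integrable_decayProfile.comp_smul (inv_ne_zero hr.ne')).comp_sub_right p

theorem integral_decayProfile_scaled {r : ℝ} (hr : 0 < r) (p : EuclideanSpace ℝ (Fin (n + 1))) :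
    ∫ x, decayProfile (r⁻¹ • (x - p)) =
      r ^ (n + 1) * ∫ x : EuclideanSpace ℝ (Fin (n + 1)), decayProfile x := by
  rw [integral_sub_right_eq_self (fun x => decayProfile (r⁻¹ • x)) p,
    Measure.integral_comp_inv_smul_of_nonneg _ _ hr.le, finrank_euclideanSpace_fin, smul_eq_mul]

/-- Decay away from `M` is dominated by a finite sum of radial profiles. -/
theorem decay_le_decayProfile {t d γ : ℝ} (ht : 0 < t) (hγ : γ ≤ √t)
    {x p : EuclideanSpace ℝ (Fin (n + 1))} (hx : ‖x - p‖ ≤ d + γ) :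
    (12 * (n + 1) * t / (d ^ 2 + 6 * (n + 1) * t)) ^ (n + 2) ≤
      (24 * (n + 1)) ^ (n + 2) * decayProfile ((√t)⁻¹ • (x - p)) := by
  have hs : 0 < √t := Real.sqrt_pos.2 ht
  have hsq : √t ^ 2 = t := Real.sq_sqrt ht.le
  rw [decayProfile, pow_mul, ← inv_pow, ← mul_pow]
  refine pow_le_pow_left₀ (by positivity) ?_ _
  rw [← div_eq_mul_inv, div_le_div_iff₀ (by positivity) (by positivity), norm_smul,
    Real.norm_of_nonneg (by positivity : 0 ≤ (√t)⁻¹)]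
  have h1 : t * (1 + (√t)⁻¹ * ‖x - p‖) ^ 2 ≤ (2 * √t + d) ^ 2 := by
    calc t * (1 + (√t)⁻¹ * ‖x - p‖) ^ 2 = (√t + ‖x - p‖) ^ 2 := by
          nth_rewrite 1 [← hsq]
          field_simp
      _ ≤ _ := by
          refine pow_le_pow_left₀ (by positivity) ?_ 2
          linarith
  -- Here `(2√t + d)² ≤ 8t + 2d²`. The resulting factor `2` turns `12(n+1)` into `24(n+1)`.
  have h2 : (2 * √t + d) ^ 2 ≤ 2 * (d ^ 2 + 6 * (n + 1) * t) := by
    have h3 : 0 ≤ (n : ℝ) * t := by positivity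
    nlinarith [sq_nonneg (2 * √t - d)]
  have h4 : (0 : ℝ) ≤ 12 * (n + 1) := by positivity
  calc 12 * (n + 1) * t * (1 + (√t)⁻¹ * ‖x - p‖) ^ 2
      = 12 * (n + 1) * (t * (1 + (√t)⁻¹ * ‖x - p‖) ^ 2) := by ring
    _ ≤ 12 * (n + 1) * (2 * (d ^ 2 + 6 * (n + 1) * t)) :=
        mul_le_mul_of_nonneg_left (h1.trans h2) h4
    _ = _ := by ring

end Covering

/-! ### The energy for short times -/

section Energy

variable {n : ℕ}

theorem abs_phaseDatum_le_one (Ω : Set (EuclideanSpace ℝ (Fin (n + 1))))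
    (x : EuclideanSpace ℝ (Fin (n + 1))) : |phaseDatum Ω x| ≤ 1 := by
  by_cases hx : x ∈ Ω
  · rw [phaseDatum, indicator_of_mem hx]; norm_num
  · rw [phaseDatum, indicator_of_notMem hx]; norm_num

theorem aestronglyMeasurable_phaseDatum {Ω : Set (EuclideanSpace ℝ (Fin (n + 1)))}
    (hΩ : IsOpen Ω) : AEStronglyMeasurable (phaseDatum Ω) := by
  refine Measurable.aestronglyMeasurable ?_
  exact ((measurable_const.indicator hΩ.measurableSet).const_mul 2).sub_const 1

/-- A ball is connected, so if it misses the frontier it lies in `Ω` or in the complement of the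
closure. -/
theorem phaseDatum_eq_on_ball {Ω : Set (EuclideanSpace ℝ (Fin (n + 1)))} (hΩ : IsOpen Ω)
    {x : EuclideanSpace ℝ (Fin (n + 1))} {d : ℝ} (hd : Disjoint (Metric.ball x d) (frontier Ω)) :
    (∀ y ∈ Metric.ball x d, phaseDatum Ω y = -1) ∨ ∀ y ∈ Metric.ball x d, -phaseDatum Ω y = -1 := by
  have hsub : Metric.ball x d ⊆ Ω ∪ (closure Ω)ᶜ := by
    intro y hy
    by_cases hyc : y ∈ closure Ω
    · left
      by_contra hyo
      exact disjoint_left.1 hd hy (by rw [hΩ.frontier_eq]; exact ⟨hyc, hyo⟩)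
    · exact Or.inr hyc
  have hpre : IsPreconnected (Metric.ball x d) := (convex_ball x d).isPreconnected
  rcases hpre.subset_or_subset hΩ isClosed_closure.isOpen_compl
    (disjoint_compl_right.mono_left subset_closure) hsub with h | h
  · right
    intro y hy
    rw [phaseDatum, indicator_of_mem (h hy)]
    norm_num
  · left
    intro y hy
    rw [phaseDatum, indicator_of_notMem fun hyo => h hy (subset_closure hyo)]
    norm_num

theorem wellPotential_nonneg (v : ℝ) : 0 ≤ wellPotential v := by
  unfold wellPotential
  positivity

/-- The well potential is `(1 - U)²(1 + U)²/2`, and `(1 - U)² ≤ 4` because `|U| ≤ 1`. -/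
theorem IsReactionSolution.deriv_sq_and_wellPotential_le {L : ℝ}
    {U₀ : EuclideanSpace ℝ (Fin (n + 1)) → ℝ} {U : SpaceTime n → ℝ}
    (h : IsReactionSolution L U₀ U) (hL : 0 ≤ L) (hm : AEStronglyMeasurable U₀)
    (h₀ : ∀ x, |U₀ x| ≤ 1) {t d : ℝ} (ht : 0 < t) (hd : 0 ≤ d)
    {x : EuclideanSpace ℝ (Fin (n + 1))} (hneg : ∀ y ∈ Metric.ball x d, U₀ y = -1)
    {q : ℝ} (hq : q = Real.exp (2 * L * t) *
        (4 * (12 * (n + 1) * t / (d ^ 2 + 6 * (n + 1) * t)) ^ (n + 2))) :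
    (∀ i : Fin (n + 1), t * dirDeriv (spaceDir i) U (t, x) ^ 2 ≤ q) ∧
      wellPotential (U (t, x)) ≤ 2 * q := by
  have hb := fun i => h.bernstein_decay hL hm h₀ ht hd hneg i
  rw [← hq] at hb
  refine ⟨fun i => ?_, ?_⟩
  · linarith [hb i, sq_nonneg (1 + U (t, x))]
  · have h1 := hb 0
    have hU := abs_le.1 (h.abs_le_one hL hm h₀ ht x)
    have h2 : 0 ≤ t * dirDeriv (spaceDir 0) U (t, x) ^ 2 := mul_nonneg ht.le (sq_nonneg _)
    have h3 : (1 - U (t, x)) ^ 2 ≤ 4 := by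
      rw [show (4 : ℝ) = 2 ^ 2 by norm_num]
      exact pow_le_pow_left₀ (by linarith) (by linarith) 2
    have h4 : wellPotential (U (t, x)) = (1 - U (t, x)) ^ 2 * (1 + U (t, x)) ^ 2 / 2 := by
      rw [wellPotential]; ring
    have h5 := mul_le_mul_of_nonneg_right h3 (sq_nonneg (1 + U (t, x)))
    rw [h4]
    linarith

theorem energyDensity_le {ε : ℝ} (hε : 0 < ε) {Ω : Set (EuclideanSpace ℝ (Fin (n + 1)))}
    (hΩ : IsOpen Ω) {u : ℝ → EuclideanSpace ℝ (Fin (n + 1)) → ℝ}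
    (hu : IsAllenCahnSolution ε (phaseDatum Ω) u) {t d : ℝ} (ht : 0 < t) (hd0 : 0 ≤ d)
    {x : EuclideanSpace ℝ (Fin (n + 1))} (hd : Disjoint (Metric.ball x d) (frontier Ω)) :
    ε * ‖gradient (u t) x‖ ^ 2 / 2 + wellPotential (u t x) / ε ≤
      8 * (n + 1) * Real.exp (4 * t / ε ^ 2) * (ε / t + 1 / ε) *
        (12 * (n + 1) * t / (d ^ 2 + 6 * (n + 1) * t)) ^ (n + 2) := by
  have hsol := hu.isReactionSolution
  have hL : 0 ≤ 2 / ε ^ 2 := by positivity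
  have hm := aestronglyMeasurable_phaseDatum hΩ
  have h0 := abs_phaseDatum_le_one Ω
  obtain ⟨U, hU⟩ : ∃ U : SpaceTime n → ℝ, U = fun p => u p.1 p.2 := ⟨_, rfl⟩
  rw [← hU] at hsol
  have hdiff : DifferentiableAt ℝ U (t, x) := (hsol.contDiffAt ht x 1).differentiableAt (by simp)
  have hgrad : ‖gradient (u t) x‖ ^ 2 = gradSq U (t, x) := by
    rw [← norm_gradient_slice_sq hdiff, hU]
  have hval : u t x = U (t, x) := by rw [hU]
  set r : ℝ := (12 * (n + 1) * t / (d ^ 2 + 6 * (n + 1) * t)) ^ (n + 2) with hr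
  have hr0 : 0 ≤ r := by positivity
  obtain ⟨q, hq⟩ : ∃ q, q = Real.exp (2 * (2 / ε ^ 2) * t) * (4 * r) := ⟨_, rfl⟩
  have hq' : q = Real.exp (4 * t / ε ^ 2) * (4 * r) := by
    rw [hq, show 2 * (2 / ε ^ 2) * t = 4 * t / ε ^ 2 by ring]
  have hq0 : 0 ≤ q := hq' ▸ by positivity
  have key : (∀ i : Fin (n + 1), t * dirDeriv (spaceDir i) U (t, x) ^ 2 ≤ q) ∧
      wellPotential (U (t, x)) ≤ 2 * q := by
    rcases phaseDatum_eq_on_ball hΩ hd with h | h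
    · exact hsol.deriv_sq_and_wellPotential_le hL hm h0 ht hd0 h hq
    · obtain ⟨h1, h2⟩ := hsol.neg.deriv_sq_and_wellPotential_le hL hm.neg
        (fun x => (abs_neg _).trans_le (h0 x)) ht hd0 h hq
      refine ⟨fun i => ?_, ?_⟩
      · have := h1 i
        simpa [dirDeriv, fderiv_fun_neg] using this
      · simpa [wellPotential] using h2
  have hsum : t * gradSq U (t, x) ≤ (n + 1) * q := by
    rw [gradSq, Finset.mul_sum]
    refine (Finset.sum_le_sum fun i _ => key.1 i).trans_eq ?_
    simp
  have h6 : ε * gradSq U (t, x) / 2 ≤ (n + 1) * q * (ε / t) / 2 := by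
    have : gradSq U (t, x) ≤ (n + 1) * q / t := by
      rw [le_div_iff₀ ht]; linarith
    calc ε * gradSq U (t, x) / 2 ≤ ε * ((n + 1) * q / t) / 2 := by gcongr
      _ = _ := by ring
  have h7 : wellPotential (U (t, x)) / ε ≤ 2 * q * (1 / ε) := by
    rw [div_eq_mul_one_div]
    gcongr
    exact key.2
  rw [hgrad, hval]
  have h8 : 0 ≤ q * (ε / t) := by positivity
  have h9 : 0 ≤ q * (1 / ε) := by positivity
  have h10 : 0 ≤ (n : ℝ) * (q * (ε / t)) := by positivity
  have h11 : 0 ≤ (n : ℝ) * (q * (1 / ε)) := by positivity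
  calc _ ≤ (n + 1) * q * (ε / t) / 2 + 2 * q * (1 / ε) := add_le_add h6 h7
    _ ≤ 2 * (n + 1) * q * (ε / t + 1 / ε) := by linarith
    _ = _ := by rw [hq']; ring

/-- A constant controlling the energy for short times. -/
noncomputable def energyConst (n : ℕ) (A : ℝ≥0) (θ : ℝ) : ℝ :=
  8 * (n + 1) * (24 * (n + 1)) ^ (n + 2) * (A * 2 ^ n / θ) *
    ∫ x : EuclideanSpace ℝ (Fin (n + 1)), decayProfile x

theorem energyConst_nonneg (A : ℝ≥0) {θ : ℝ} (hθ : 0 ≤ θ) : 0 ≤ energyConst n A θ := by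
  have : 0 ≤ ∫ x : EuclideanSpace ℝ (Fin (n + 1)), decayProfile x :=
    integral_nonneg decayProfile_nonneg
  unfold energyConst
  positivity

/-- A net of `M` at scale `γ ≤ √t` replaces the distance to `M` by distances to finitely many
points, and each profile integrates to a multiple of `√t^(n+1)`. Keeping `γ` free allows `γ ~ √t`
for the sharp bound, and a fixed `γ` for a bound uniform on compact time intervals. -/
theorem allenCahnEnergy_le_of_cover {ε : ℝ} (hε : 0 < ε) {A : ℝ≥0} {κ δ θ : ℝ}
    {Ω M : Set (EuclideanSpace ℝ (Fin (n + 1)))} (hM : IsGeneralisedHypersurface n κ δ θ Ω M)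
    (hA : μH[(n : ℝ)] M ≤ (A : ℝ≥0∞)) {u : ℝ → EuclideanSpace ℝ (Fin (n + 1)) → ℝ}
    (hu : IsAllenCahnSolution ε (phaseDatum Ω) u) {t γ : ℝ} (ht : 0 < t) (hγ : γ ∈ Ioc 0 δ)
    (hγt : γ ≤ √t) :
    allenCahnEnergy ε (u t) ≤ ENNReal.ofReal (energyConst n A θ * Real.exp (4 * t / ε ^ 2) *
      (ε / t + 1 / ε) * (√t ^ (n + 1) / γ ^ n)) := by
  have hθ := hM.density_pos
  have hs : 0 < √t := Real.sqrt_pos.2 ht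
  have hγ0 : 0 < γ := hγ.1
  have hclosed : IsClosed M := hM.eq_frontier ▸ isClosed_frontier
  rcases M.eq_empty_or_nonempty with hemp | hne
  -- With no interface the decay estimate holds for every `d`, and `d → ∞` makes the density vanish.
  · have hzero : ∀ x, ε * ‖gradient (u t) x‖ ^ 2 / 2 + wellPotential (u t x) / ε ≤ 0 := by
      intro x
      have hle : ∀ d : ℝ, 0 ≤ d → ε * ‖gradient (u t) x‖ ^ 2 / 2 + wellPotential (u t x) / ε ≤
          8 * ((n : ℝ) + 1) * Real.exp (4 * t / ε ^ 2) * (ε / t + 1 / ε) *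
            (12 * (n + 1) * t / (d ^ 2 + 6 * (n + 1) * t)) ^ (n + 2) :=
        fun d hd => energyDensity_le hε hM.isOpen hu ht hd (x := x) (by
          rw [← hM.eq_frontier, hemp]; exact disjoint_empty _)
      have hlim : Tendsto (fun d : ℝ => 8 * ((n : ℝ) + 1) * Real.exp (4 * t / ε ^ 2) *
          (ε / t + 1 / ε) * (12 * (n + 1) * t / (d ^ 2 + 6 * (n + 1) * t)) ^ (n + 2)) atTop
          (𝓝 (8 * ((n : ℝ) + 1) * Real.exp (4 * t / ε ^ 2) *
          (ε / t + 1 / ε) * 0 ^ (n + 2))) := by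
        refine Tendsto.const_mul _ (Tendsto.pow ?_ _)
        refine tendsto_const_nhds.div_atTop ?_
        exact tendsto_atTop_add_const_right _ _ (tendsto_pow_atTop (by norm_num))
      rw [zero_pow (by omega), mul_zero] at hlim
      exact ge_of_tendsto hlim (by filter_upwards [eventually_ge_atTop 0] with d hd using hle d hd)
    rw [allenCahnEnergy, lintegral_congr fun x => ENNReal.ofReal_of_nonpos (hzero x)]
    simp
  -- If `κ > 0`, finiteness of `ℋⁿ(M)` forces `ℋ^(n+κ)(M) = 0`, against the density bound at any
  -- point of `M`.
  · have hκ : κ = 0 := by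
      by_contra hκ
      have hlt : (n : ℝ) < n + κ := by
        have := lt_of_le_of_ne hM.exponent_mem.1 (Ne.symm hκ)
        linarith
      have hz : μH[(n : ℝ) + κ] M = 0 :=
        (Measure.hausdorffMeasure_zero_or_top hlt M).resolve_right fun htop => by
          rw [htop] at hA
          exact absurd hA (by simp)
      obtain ⟨p, hp⟩ := hne
      have h1 := hM.density p hp δ ⟨hM.scale_pos, le_rfl⟩
      have h2 := h1.trans ((measure_mono inter_subset_left).trans_eq hz)
      have h3 : 0 < θ * δ ^ ((n : ℝ) + κ) := mul_pos hθ (Real.rpow_pos_of_pos hM.scale_pos _)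
      exact absurd (nonpos_iff_eq_zero.1 h2) (by simpa using h3)
    have hdens : HasLowerDensityBound (n : ℝ) δ θ M := by
      have := hM.density
      rwa [hκ, add_zero] at this
    obtain ⟨S, hScard, hScov⟩ := exists_finite_cover hclosed hdens hθ hA hγ
    set B : ℝ := 8 * (n + 1) * Real.exp (4 * t / ε ^ 2) * (ε / t + 1 / ε) with hB
    have hB0 : 0 ≤ B := by positivity
    have hpt : ∀ x, ε * ‖gradient (u t) x‖ ^ 2 / 2 + wellPotential (u t x) / ε ≤
        B * (24 * (n + 1)) ^ (n + 2) * ∑ p ∈ S, decayProfile ((√t)⁻¹ • (x - p)) := by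
      intro x
      obtain ⟨y, hyM, hy⟩ := hclosed.exists_infDist_eq_dist hne x
      obtain ⟨p, hpS, hp⟩ := hScov y hyM
      have hxp : ‖x - p‖ ≤ Metric.infDist x M + γ := by
        rw [← dist_eq_norm, hy]
        linarith [dist_triangle x y p]
      have hdisj : Disjoint (Metric.ball x (Metric.infDist x M)) (frontier Ω) := by
        rw [← hM.eq_frontier]
        exact Metric.disjoint_ball_infDist
      refine (energyDensity_le hε hM.isOpen hu ht Metric.infDist_nonneg hdisj).trans ?_
      rw [mul_assoc B]
      refine mul_le_mul_of_nonneg_left ?_ hB0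
      refine (decay_le_decayProfile ht hγt hxp).trans ?_
      refine mul_le_mul_of_nonneg_left ?_ (by positivity)
      exact Finset.single_le_sum (f := fun p => decayProfile ((√t)⁻¹ • (x - p)))
        (fun _ _ => decayProfile_nonneg _) hpS
    have hint : Integrable fun x => B * (24 * ((n : ℝ) + 1)) ^ (n + 2) *
        ∑ p ∈ S, decayProfile ((√t)⁻¹ • (x - p)) :=
      (integrable_finsetSum _ fun p _ => integrable_decayProfile_scaled hs p).const_mul _
    refine (lintegral_mono fun x => ENNReal.ofReal_le_ofReal (hpt x)).trans ?_
    rw [← ofReal_integral_eq_lintegral_ofReal hint (Eventually.of_forall fun x =>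
      mul_nonneg (by positivity) (Finset.sum_nonneg fun p _ => decayProfile_nonneg _))]
    refine ENNReal.ofReal_le_ofReal ?_
    rw [integral_const_mul, integral_finsetSum _ fun p _ => integrable_decayProfile_scaled hs p,
      Finset.sum_congr rfl fun p _ => integral_decayProfile_scaled hs p, Finset.sum_const,
      nsmul_eq_mul]
    have hI : 0 ≤ ∫ x : EuclideanSpace ℝ (Fin (n + 1)), decayProfile x :=
      integral_nonneg decayProfile_nonneg
    calc B * (24 * ((n : ℝ) + 1)) ^ (n + 2) * (S.card * (√t ^ (n + 1) *
          ∫ x : EuclideanSpace ℝ (Fin (n + 1)), decayProfile x))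
        ≤ B * (24 * ((n : ℝ) + 1)) ^ (n + 2) * (A * 2 ^ n / (θ * γ ^ n) * (√t ^ (n + 1) *
          ∫ x : EuclideanSpace ℝ (Fin (n + 1)), decayProfile x)) := by gcongr
      _ = _ := by
          rw [hB, energyConst]
          field_simp

end Energy

/-! ### Monotonicity of the energy -/

section Monotonicity

variable {n : ℕ}

/-- The Allen–Cahn energy density in space-time. -/
noncomputable def energyDensity (ε : ℝ) (U : SpaceTime n → ℝ) (p : SpaceTime n) : ℝ :=
  ε / 2 * gradSq U p + wellPotential (U p) / ε

theorem contDiff_wellPotential {k : ℕ∞ω} : ContDiff ℝ k wellPotential := by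
  unfold wellPotential
  fun_prop

theorem energyDensity_nonneg {ε : ℝ} (hε : 0 < ε) (U : SpaceTime n → ℝ) (p : SpaceTime n) :
    0 ≤ energyDensity ε U p :=
  add_nonneg (mul_nonneg (by positivity) (gradSq_nonneg _ _))
    (div_nonneg (wellPotential_nonneg _) hε.le)

theorem contDiffOn_energyDensity {I : Set ℝ} (hI : IsOpen I) (ε : ℝ) {U : SpaceTime n → ℝ}
    (hU : ContDiffOn ℝ 2 U (I ×ˢ univ)) : ContDiffOn ℝ 1 (energyDensity ε U) (I ×ˢ univ) := by
  have h1 : ContDiffOn ℝ 1 (gradSq U) (I ×ˢ univ) :=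
    ContDiffOn.sum fun i _ => (ContDiffOn.dirDeriv_slab hI hU (by norm_num) _).pow 2
  exact (contDiffOn_const.mul h1).add
    ((contDiff_wellPotential.comp_contDiffOn (hU.of_le (by norm_num))).div_const ε)

/-- Local energy identity: the equation replaces `F'(U)/ε` by `ε(ΔU - ∂ₜU)`, and `∇U·∇∂ₜU + ∂ₜU ΔU`
is the divergence of `∂ₜU ∇U`. -/
theorem IsReactionSolution.dirDeriv_time_energyDensity {ε : ℝ} (hε : 0 < ε)
    {U₀ : EuclideanSpace ℝ (Fin (n + 1)) → ℝ} {U : SpaceTime n → ℝ}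
    (h : IsReactionSolution (2 / ε ^ 2) U₀ U) {t : ℝ} (ht : 0 < t)
    (y : EuclideanSpace ℝ (Fin (n + 1))) :
    dirDeriv (timeDir n) (energyDensity ε U) (t, y) =
      ε * (∑ i, dirDeriv (spaceDir i)
        (fun p => dirDeriv (timeDir n) U p * dirDeriv (spaceDir i) U p) (t, y) -
          dirDeriv (timeDir n) U (t, y) ^ 2) := by
  have hU2 := h.contDiffAt ht y 2
  have hU1 : DifferentiableAt ℝ U (t, y) := hU2.differentiableAt (by simp)
  have hd : ∀ v : SpaceTime n, DifferentiableAt ℝ (dirDeriv v U) (t, y) := fun v =>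
    (hU2.dirDeriv (m := 1) (by norm_num) v).differentiableAt (by simp)
  have hsq : ∀ i : Fin (n + 1), DifferentiableAt ℝ (fun p => dirDeriv (spaceDir i) U p ^ 2) (t, y) :=
    fun i => (hd _).pow 2
  have hgrad : DifferentiableAt ℝ (gradSq U) (t, y) := DifferentiableAt.fun_sum fun i _ => hsq i
  have hW : DifferentiableAt ℝ (fun p => wellPotential (U p)) (t, y) :=
    ((contDiff_wellPotential (k := 1)).differentiable (by simp) _).fun_comp' _ hU1
  have hc1 : DifferentiableAt ℝ (fun p => ε / 2 * gradSq U p) (t, y) := hgrad.const_mul _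
  have hc2 : DifferentiableAt ℝ (fun p => ε⁻¹ * wellPotential (U p)) (t, y) := hW.const_mul _
  have e1 : dirDeriv (timeDir n) (gradSq U) (t, y) = ∑ i, 2 * (dirDeriv (spaceDir i) U (t, y) *
      dirDeriv (spaceDir i) (dirDeriv (timeDir n) U) (t, y)) := by
    rw [dirDeriv, show gradSq U = fun p => ∑ i, dirDeriv (spaceDir i) U p ^ 2 from rfl,
      fderiv_fun_sum fun i _ => hsq i, _root_.sum_apply]
    refine Finset.sum_congr rfl fun i _ => ?_
    have := dirDeriv_comp (φ := fun r => r ^ 2) (by fun_prop) (hd (spaceDir i)) (timeDir n)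
    rw [dirDeriv] at this
    rw [this, dirDeriv_comm hU2]
    simp
    ring
  have e2 : energyDensity ε U = fun p => ε / 2 * gradSq U p + ε⁻¹ * wellPotential (U p) := by
    funext p
    rw [energyDensity, div_eq_inv_mul (wellPotential _)]
  have e3 : dirDeriv (timeDir n) (fun p => wellPotential (U p)) (t, y) =
      -2 * (U (t, y) - U (t, y) ^ 3) * dirDeriv (timeDir n) U (t, y) := by
    rw [dirDeriv_comp ((contDiff_wellPotential (k := 1)).differentiable (by simp) _) hU1,
      deriv_wellPotential]
  have e4 := h.heat_eq (t, y) ht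
  rw [heat] at e4
  rw [e2, dirDeriv_add hc1 hc2, dirDeriv_mul (differentiableAt_const _) hgrad,
    dirDeriv_mul (differentiableAt_const _) hW, dirDeriv_const, dirDeriv_const, e1, e3]
  simp only [dirDeriv_mul (hd (timeDir n)) (hd (spaceDir _)), Finset.sum_add_distrib,
    ← Finset.mul_sum]
  have e5 : ∑ i, dirDeriv (spaceDir i) (dirDeriv (spaceDir i) U) (t, y) =
      dirDeriv (timeDir n) U (t, y) - 2 / ε ^ 2 * (U (t, y) - U (t, y) ^ 3) := by linarith
  have e6 : ∑ i, dirDeriv (spaceDir i) (dirDeriv (timeDir n) U) (t, y) * dirDeriv (spaceDir i) U (t, y)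
      = ∑ i, dirDeriv (spaceDir i) U (t, y) *
        dirDeriv (spaceDir i) (dirDeriv (timeDir n) U) (t, y) :=
    Finset.sum_congr rfl fun i _ => mul_comm _ _
  rw [e5, e6]
  field_simp
  ring

theorem integral_mul_dirDeriv_spaceDir {I : Set ℝ} (hI : IsOpen I)
    {φ : EuclideanSpace ℝ (Fin (n + 1)) → ℝ} (hφ : ContDiff ℝ 1 φ) (hφc : HasCompactSupport φ)
    {g : SpaceTime n → ℝ} (hg : ContDiffOn ℝ 1 g (I ×ˢ univ)) {t : ℝ} (ht : t ∈ I)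
    (i : Fin (n + 1)) :
    ∫ y, φ y * dirDeriv (spaceDir i) g (t, y) =
      -∫ y, dirDeriv (EuclideanSpace.single i 1) φ y * g (t, y) := by
  have hdiff : ∀ y, DifferentiableAt ℝ g (t, y) := fun y =>
    (contDiffAt_of_slab hI hg ht y).differentiableAt (by simp)
  have hslice : ∀ y, fderiv ℝ (fun z => g (t, z)) y (EuclideanSpace.single i 1) =
      dirDeriv (spaceDir i) g (t, y) := fun y => dirDeriv_slice (hdiff y) _
  have hgc : Continuous fun y => g (t, y) := continuous_slice hg.continuousOn ht
  have hdc : Continuous fun y => dirDeriv (spaceDir i) g (t, y) :=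
    continuous_slice (ContDiffOn.dirDeriv_slab (m := 0) hI hg (by simp) _).continuousOn ht
  have hφd : Continuous fun y => fderiv ℝ φ y (EuclideanSpace.single i 1) :=
    (hφ.continuous_fderiv (by simp)).clm_apply continuous_const
  have := integral_mul_fderiv_eq_neg_fderiv_mul_of_integrable (μ := volume) (𝕜 := ℝ) (f := φ)
    (g := fun z => g (t, z)) (v := EuclideanSpace.single i 1)
    ((hφd.mul hgc).integrable_of_hasCompactSupport (hφc.fderiv_apply ℝ _).mul_right)
    (by
      simp only [hslice]
      exact (hφ.continuous.mul hdc).integrable_of_hasCompactSupport hφc.mul_right)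
    ((hφ.continuous.mul hgc).integrable_of_hasCompactSupport hφc.mul_right)
    (fun y _ => hφ.differentiable (by simp) y)
    (fun y _ => (hdiff y).comp y (by fun_prop))
  simp only [hslice] at this
  exact this

/-- After integration by parts against `η²`, the flux term `-2η ∂ₜU ∇η·∇U` is absorbed by the
dissipation `-η²(∂ₜU)²` up to `(∇η·∇U)²`, which is at most `ρ|∇U|²`. -/
theorem IsReactionSolution.integral_sq_mul_dirDeriv_energyDensity_le {ε : ℝ} (hε : 0 < ε)
    {U₀ : EuclideanSpace ℝ (Fin (n + 1)) → ℝ} {U : SpaceTime n → ℝ}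
    (h : IsReactionSolution (2 / ε ^ 2) U₀ U) {η : EuclideanSpace ℝ (Fin (n + 1)) → ℝ}
    (hη : ContDiff ℝ 1 η) (hηc : HasCompactSupport η) {ρ : ℝ}
    (hρ : ∀ y, ∑ i, dirDeriv (EuclideanSpace.single i 1) η y ^ 2 ≤ ρ) {t : ℝ} (ht : 0 < t)
    (hint : Integrable fun y => energyDensity ε U (t, y)) :
    ∫ y, η y ^ 2 * dirDeriv (timeDir n) (energyDensity ε U) (t, y) ≤
      2 * ρ * ∫ y, energyDensity ε U (t, y) := by
  have hU2 := h.contDiffOn_two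
  have hd : ∀ v, ContDiffOn ℝ 1 (dirDeriv v U) (Ioi 0 ×ˢ univ) := fun v =>
    ContDiffOn.dirDeriv_slab isOpen_Ioi hU2 (by norm_num) v
  have hdc : ∀ v, Continuous fun y => dirDeriv v U (t, y) := fun v =>
    continuous_slice (hd v).continuousOn (show t ∈ Ioi 0 from ht)
  have hg : ∀ i, ContDiffOn ℝ 1 (fun p => dirDeriv (timeDir n) U p * dirDeriv (spaceDir i) U p)
      (Ioi 0 ×ˢ univ) := fun i => (hd _).mul (hd _)
  have hgd : ∀ i : Fin (n + 1), Continuous fun y => dirDeriv (spaceDir i)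
      (fun p => dirDeriv (timeDir n) U p * dirDeriv (spaceDir i) U p) (t, y) := fun i =>
    continuous_slice (ContDiffOn.dirDeriv_slab (m := 0) isOpen_Ioi (hg i) (by simp) _).continuousOn
      (show t ∈ Ioi 0 from ht)
  have hη2c : HasCompactSupport fun y => η y ^ 2 := by
    simpa only [pow_two] using! hηc.mul_right (f' := η)
  have hη2 : ContDiff ℝ 1 fun y => η y ^ 2 := hη.pow 2
  have hηd : ∀ i : Fin (n + 1), Continuous fun y => dirDeriv (EuclideanSpace.single i 1) η y :=
    fun i => (hη.continuous_fderiv (by simp)).clm_apply continuous_const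
  have hηd2 : ∀ (i : Fin (n + 1)) y, dirDeriv (EuclideanSpace.single i 1) (fun y => η y ^ 2) y =
      2 * η y * dirDeriv (EuclideanSpace.single i 1) η y := by
    intro i y
    rw [dirDeriv_comp (φ := fun r => r ^ 2) (by fun_prop) (hη.differentiable (by simp) y)]
    simp
  set V : EuclideanSpace ℝ (Fin (n + 1)) → ℝ := fun y => dirDeriv (timeDir n) U (t, y) with hV
  have hVc : Continuous V := hdc _
  have hcs : ∀ {f : EuclideanSpace ℝ (Fin (n + 1)) → ℝ}, Continuous f →
      Integrable fun y => η y ^ 2 * f y := fun hf =>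
    (hη2.continuous.mul hf).integrable_of_hasCompactSupport hη2c.mul_right
  have hcs1 : ∀ {f : EuclideanSpace ℝ (Fin (n + 1)) → ℝ}, Continuous f →
      Integrable fun y => η y * f y := fun hf =>
    (hη.continuous.mul hf).integrable_of_hasCompactSupport hηc.mul_right
  have hV2 : Integrable fun y => η y ^ 2 * V y ^ 2 := hcs (f := fun y => V y ^ 2) (hVc.pow 2)
  have e1 : ∫ y, η y ^ 2 * dirDeriv (timeDir n) (energyDensity ε U) (t, y) =
      ε * ((∑ i, ∫ y, η y ^ 2 * dirDeriv (spaceDir i)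
        (fun p => dirDeriv (timeDir n) U p * dirDeriv (spaceDir i) U p) (t, y)) -
          ∫ y, η y ^ 2 * V y ^ 2) := by
    rw [← integral_finsetSum _ fun i _ => hcs (hgd i),
      ← integral_sub (integrable_finsetSum _ fun i _ => hcs (hgd i)) hV2,
      ← integral_const_mul]
    refine integral_congr_ae (Eventually.of_forall fun y => ?_)
    simp only
    rw [h.dirDeriv_time_energyDensity hε ht, ← Finset.mul_sum]
    ring
  have e2 : ∀ i : Fin (n + 1), ∫ y, η y ^ 2 * dirDeriv (spaceDir i)
      (fun p => dirDeriv (timeDir n) U p * dirDeriv (spaceDir i) U p) (t, y) =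
      ∫ y, η y * (-(2 * dirDeriv (EuclideanSpace.single i 1) η y *
        (V y * dirDeriv (spaceDir i) U (t, y)))) := by
    intro i
    rw [integral_mul_dirDeriv_spaceDir isOpen_Ioi hη2 hη2c (hg i) (show t ∈ Ioi 0 from ht),
      ← integral_neg]
    refine integral_congr_ae (Eventually.of_forall fun y => ?_)
    simp only [hηd2, hV]
    ring
  have hi2 : ∀ i : Fin (n + 1), Integrable fun y =>
      η y * (-(2 * dirDeriv (EuclideanSpace.single i 1) η y *
        (V y * dirDeriv (spaceDir i) U (t, y)))) := fun i =>
    hcs1 ((((hηd i).const_mul 2).mul (hVc.mul (hdc _))).neg)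
  rw [e1, Finset.sum_congr rfl fun i _ => e2 i, ← integral_finsetSum _ fun i _ => hi2 i,
    ← integral_sub (integrable_finsetSum _ fun i _ => hi2 i) hV2,
    ← integral_const_mul, ← integral_const_mul]
  have hρ0 : 0 ≤ ρ := (Finset.sum_nonneg fun i _ => sq_nonneg _).trans (hρ 0)
  refine integral_mono (((integrable_finsetSum _ fun i _ => hi2 i).sub
    hV2).const_mul ε) (hint.const_mul _) fun y => ?_
  set S : ℝ := ∑ i, dirDeriv (EuclideanSpace.single i 1) η y * dirDeriv (spaceDir i) U (t, y)
  have e3 : ∑ i, η y * (-(2 * dirDeriv (EuclideanSpace.single i 1) η y *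
      (V y * dirDeriv (spaceDir i) U (t, y)))) = -2 * (η y * V y) * S := by
    rw [Finset.mul_sum]
    exact Finset.sum_congr rfl fun i _ => by ring
  have e4 : S ^ 2 ≤ ρ * gradSq U (t, y) :=
    (Finset.sum_mul_sq_le_sq_mul_sq _ _ _).trans
      (mul_le_mul_of_nonneg_right (hρ y) (gradSq_nonneg _ _))
  have e5 : ε / 2 * gradSq U (t, y) ≤ energyDensity ε U (t, y) :=
    le_add_of_nonneg_right (div_nonneg (wellPotential_nonneg _) hε.le)
  simp only [e3]
  calc ε * (-2 * (η y * V y) * S - η y ^ 2 * V y ^ 2)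
      ≤ ε * S ^ 2 := mul_le_mul_of_nonneg_left
        (by linarith [sq_nonneg (η y * V y + S), mul_pow (η y) (V y) 2]) hε.le
    _ ≤ ε * (ρ * gradSq U (t, y)) := mul_le_mul_of_nonneg_left e4 hε.le
    _ = 2 * ρ * (ε / 2 * gradSq U (t, y)) := by ring
    _ ≤ _ := mul_le_mul_of_nonneg_left e5 (by positivity)

/-- Cutoffs at scale `k + 1` have squared gradient of order `(k + 1)⁻²`, so with the energy bounded
by `G` the total error over the time interval tends to `0` as `k → ∞`. -/
theorem IsReactionSolution.integral_energyDensity_le {ε : ℝ} (hε : 0 < ε)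
    {U₀ : EuclideanSpace ℝ (Fin (n + 1)) → ℝ} {U : SpaceTime n → ℝ}
    (h : IsReactionSolution (2 / ε ^ 2) U₀ U) {s t G : ℝ} (hs : 0 < s) (hst : s ≤ t)
    (hint : ∀ r ∈ Icc s t, Integrable fun y => energyDensity ε U (r, y))
    (hG : ∀ r ∈ Icc s t, ∫ y, energyDensity ε U (r, y) ≤ G) :
    ∫ y, energyDensity ε U (t, y) ≤ ∫ y, energyDensity ε U (s, y) := by
  let f : ContDiffBump (0 : EuclideanSpace ℝ (Fin (n + 1))) :=
    { rIn := 1, rOut := 2, rIn_pos := by norm_num, rIn_lt_rOut := by norm_num }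
  have hfs : ContDiff ℝ 1 f := f.contDiff
  obtain ⟨Λ, hΛ⟩ := hfs.lipschitzWith_of_hasCompactSupport f.hasCompactSupport (by simp)
  have he := contDiffOn_energyDensity isOpen_Ioi ε h.contDiffOn_two
  have key : ∀ k : ℕ, ∫ y, f ((k + 1 : ℝ)⁻¹ • y) ^ 2 * energyDensity ε U (t, y) ≤
      (∫ y, energyDensity ε U (s, y)) +
        2 * ((n + 1) * (Λ * (k + 1 : ℝ)⁻¹) ^ 2) * G * (t - s) := by
    intro k
    set c : ℝ := (k + 1 : ℝ)⁻¹ with hc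
    have hc0 : 0 < c := by positivity
    set η : EuclideanSpace ℝ (Fin (n + 1)) → ℝ := fun y => f (c • y) with hηdef
    have hη : ContDiff ℝ 1 η := hfs.comp (contDiff_const_smul c)
    have hηc : HasCompactSupport η := f.hasCompactSupport.comp_smul hc0.ne'
    have hη2c : HasCompactSupport fun y => η y ^ 2 := by
      simpa only [pow_two] using! hηc.mul_right (f' := η)
    have hρ : ∀ y, ∑ i, dirDeriv (EuclideanSpace.single i 1) η y ^ 2 ≤ (n + 1) * (Λ * c) ^ 2 := by
      intro y
      have hlip : LipschitzWith (Λ * ⟨c, hc0.le⟩) η := by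
        refine hΛ.comp (LipschitzWith.of_dist_le_mul fun x z => ?_)
        rw [dist_smul₀, Real.norm_of_nonneg hc0.le]
        rfl
      have hb : ∀ i : Fin (n + 1), dirDeriv (EuclideanSpace.single i 1) η y ^ 2 ≤ (Λ * c) ^ 2 := by
        intro i
        refine sq_le_sq.2 ?_
        rw [abs_of_nonneg (by positivity : 0 ≤ (Λ : ℝ) * c)]
        calc |dirDeriv (EuclideanSpace.single i 1) η y|
            ≤ ‖fderiv ℝ η y‖ * ‖(EuclideanSpace.single i 1 : EuclideanSpace ℝ (Fin (n + 1)))‖ :=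
              (fderiv ℝ η y).le_opNorm _
          _ ≤ Λ * c := by
              exact (le_of_eq (by simp)).trans (norm_fderiv_le_of_lipschitz ℝ hlip (x₀ := y))
      refine (Finset.sum_le_sum fun i _ => hb i).trans_eq ?_
      simp
    have hderiv : ∀ r ∈ Icc s t, HasDerivAt (fun r => ∫ y, η y ^ 2 * energyDensity ε U (r, y))
        (∫ y, η y ^ 2 * dirDeriv (timeDir n) (energyDensity ε U) (r, y)) r := fun r hr =>
      hasDerivAt_integral_mul isOpen_Ioi (hη.continuous.pow 2) hη2c he
        (show r ∈ Ioi 0 from hs.trans_le hr.1)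
    have hmvt := (convex_Icc s t).image_sub_le_mul_sub_of_deriv_le
      (f := fun r => ∫ y, η y ^ 2 * energyDensity ε U (r, y))
      (fun r hr => (hderiv r hr).continuousAt.continuousWithinAt)
      (fun r hr => (hderiv r (interior_subset hr)).differentiableAt.differentiableWithinAt)
      (C := 2 * ((n + 1) * (Λ * c) ^ 2) * G) (fun r hr => by
        have hr' := interior_subset hr
        rw [(hderiv r hr').deriv]
        refine (h.integral_sq_mul_dirDeriv_energyDensity_le hε hη hηc hρ (hs.trans_le hr'.1)
          (hint r hr')).trans ?_
        exact mul_le_mul_of_nonneg_left (hG r hr') (by positivity))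
      s (left_mem_Icc.2 hst) t (right_mem_Icc.2 hst) hst
    have hle : ∫ y, η y ^ 2 * energyDensity ε U (s, y) ≤ ∫ y, energyDensity ε U (s, y) := by
      refine integral_mono_of_nonneg (Eventually.of_forall fun y =>
        mul_nonneg (sq_nonneg _) (energyDensity_nonneg hε _ _)) (hint s (left_mem_Icc.2 hst))
        (Eventually.of_forall fun y => ?_)
      exact mul_le_of_le_one_left (energyDensity_nonneg hε _ _)
        (pow_le_one₀ f.nonneg f.le_one)
    linarith
  have hinv : Tendsto (fun k : ℕ => (k + 1 : ℝ)⁻¹) atTop (𝓝 0) := by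
    simpa [one_div] using tendsto_one_div_add_atTop_nhds_zero_nat (𝕜 := ℝ)
  have hr : Tendsto (fun k : ℕ => (∫ y, energyDensity ε U (s, y)) +
      2 * ((n + 1) * (Λ * (k + 1 : ℝ)⁻¹) ^ 2) * G * (t - s)) atTop
      (𝓝 (∫ y, energyDensity ε U (s, y))) := by
    have := ((((((hinv.const_mul (Λ : ℝ)).pow 2).const_mul ((n : ℝ) + 1)).const_mul 2).mul_const
      G).mul_const (t - s)).const_add (∫ y, energyDensity ε U (s, y))
    simpa using this
  have hl : Tendsto (fun k : ℕ => ∫ y, f ((k + 1 : ℝ)⁻¹ • y) ^ 2 * energyDensity ε U (t, y)) atTop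
      (𝓝 (∫ y, energyDensity ε U (t, y))) := by
    have hc : Continuous fun y => energyDensity ε U (t, y) :=
      continuous_slice he.continuousOn (show t ∈ Ioi 0 from hs.trans_le hst)
    refine tendsto_integral_of_dominated_convergence (fun y => energyDensity ε U (t, y))
      (fun k => ?_) (hint t (right_mem_Icc.2 hst)) (fun k => Eventually.of_forall fun y => ?_)
      (Eventually.of_forall fun y => ?_)
    · exact (((f.continuous.comp (continuous_const_smul _)).pow 2).mul hc).aestronglyMeasurable
    · rw [Real.norm_of_nonneg (mul_nonneg (sq_nonneg _) (energyDensity_nonneg hε _ _))]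
      exact mul_le_of_le_one_left (energyDensity_nonneg hε _ _)
        (pow_le_one₀ f.nonneg f.le_one)
    · have h1 : Tendsto (fun k : ℕ => f ((k + 1 : ℝ)⁻¹ • y)) atTop (𝓝 (f ((0 : ℝ) • y))) :=
        (f.continuous.tendsto _).comp (hinv.smul_const y)
      have h2 : f ((0 : ℝ) • y) = 1 := by
        rw [zero_smul]
        exact f.one_of_mem_closedBall (by simp [f])
      rw [h2] at h1
      simpa using (h1.pow 2).mul_const (energyDensity ε U (t, y))
  exact le_of_tendsto_of_tendsto' hl hr key

theorem allenCahnEnergy_eq {ε : ℝ} {U : SpaceTime n → ℝ} {t : ℝ}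
    (hU : ∀ x, DifferentiableAt ℝ U (t, x)) :
    allenCahnEnergy ε (fun x => U (t, x)) = ∫⁻ x, ENNReal.ofReal (energyDensity ε U (t, x)) := by
  refine lintegral_congr fun x => ?_
  rw [norm_gradient_slice_sq (hU x), energyDensity]
  congr 2
  ring

theorem allenCahnEnergy_antitone {ε : ℝ} (hε : 0 < ε) {u₀ : EuclideanSpace ℝ (Fin (n + 1)) → ℝ}
    {u : ℝ → EuclideanSpace ℝ (Fin (n + 1)) → ℝ} (hu : IsAllenCahnSolution ε u₀ u)
    {s t G : ℝ} (hs : 0 < s) (hst : s ≤ t)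
    (hG : ∀ r ∈ Icc s t, allenCahnEnergy ε (u r) ≤ ENNReal.ofReal G) :
    allenCahnEnergy ε (u t) ≤ allenCahnEnergy ε (u s) := by
  have hsol := hu.isReactionSolution
  obtain ⟨U, hU⟩ : ∃ U : SpaceTime n → ℝ, U = fun p => u p.1 p.2 := ⟨_, rfl⟩
  rw [← hU] at hsol
  have he := contDiffOn_energyDensity isOpen_Ioi ε hsol.contDiffOn_two
  have heq : ∀ r > 0, allenCahnEnergy ε (u r) =
      ∫⁻ x, ENNReal.ofReal (energyDensity ε U (r, x)) := by
    intro r hr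
    rw [← allenCahnEnergy_eq fun x => (hsol.contDiffAt hr x 1).differentiableAt (by simp), hU]
  have hint : ∀ r ∈ Icc s t, Integrable fun y => energyDensity ε U (r, y) := by
    intro r hr
    have hr0 : 0 < r := hs.trans_le hr.1
    have hc : Continuous fun y => energyDensity ε U (r, y) :=
      continuous_slice he.continuousOn (show r ∈ Ioi 0 from hr0)
    refine ⟨hc.aestronglyMeasurable, ?_⟩
    rw [hasFiniteIntegral_iff_ofReal (Eventually.of_forall fun y => energyDensity_nonneg hε _ _),
      ← heq r hr0]
    exact (hG r hr).trans_lt ENNReal.ofReal_lt_top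
  have hval : ∀ r ∈ Icc s t, allenCahnEnergy ε (u r) =
      ENNReal.ofReal (∫ y, energyDensity ε U (r, y)) := by
    intro r hr
    rw [heq r (hs.trans_le hr.1), ofReal_integral_eq_lintegral_ofReal (hint r hr)
      (Eventually.of_forall fun y => energyDensity_nonneg hε _ _)]
  rw [hval s (left_mem_Icc.2 hst), hval t (right_mem_Icc.2 hst)]
  -- `ENNReal.ofReal` truncates at zero, so a negative `G` only gives the bound `0`; hence `max G
  -- 0`.
  refine ENNReal.ofReal_le_ofReal (hsol.integral_energyDensity_le hε hs hst hint (G := max G 0)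
    fun r hr => ?_)
  have := hG r hr
  rw [hval r hr] at this
  rcases le_total (∫ y, energyDensity ε U (r, y)) 0 with h0 | h0
  · exact h0.trans (le_max_right _ _)
  · by_cases hG0 : 0 ≤ G
    · exact ((ENNReal.ofReal_le_ofReal_iff hG0).1 this).trans (le_max_left _ _)
    · rw [ENNReal.ofReal_of_nonpos (not_le.1 hG0).le, nonpos_iff_eq_zero,
        ENNReal.ofReal_eq_zero] at this
      exact this.trans (le_max_right _ _)

end Monotonicity

/-! ### The main theorem -/

theorem allenCahnEnergy_short_time {n : ℕ} {ε : ℝ} (hε : ε ∈ Ioo (0 : ℝ) 1) {A : ℝ≥0} {κ δ θ : ℝ}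
    {Ω M : Set (EuclideanSpace ℝ (Fin (n + 1)))} (hM : IsGeneralisedHypersurface n κ δ θ Ω M)
    (hA : μH[(n : ℝ)] M ≤ (A : ℝ≥0∞)) {u : ℝ → EuclideanSpace ℝ (Fin (n + 1)) → ℝ}
    (hu : IsAllenCahnSolution ε (phaseDatum Ω) u) {t : ℝ} (ht : t ∈ Ioc 0 (ε ^ 2)) :
    allenCahnEnergy ε (u t) ≤ ENNReal.ofReal
      (energyConst n A θ * Real.exp 4 / min δ 1 ^ n * (ε / √t + √t / ε)) := by
  have hε0 : 0 < ε := hε.1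
  have hm : 0 < min δ 1 := lt_min hM.scale_pos one_pos
  have hs : 0 < √t := Real.sqrt_pos.2 ht.1
  have hs1 : √t ≤ 1 := by
    rw [Real.sqrt_le_one]
    exact ht.2.trans (pow_le_one₀ hε0.le hε.2.le)
  -- The net scale is proportional to `√t`, so `√t^(n+1)/γⁿ` is linear in `√t`; since `√t ≤ 1`, the
  -- factor `min δ 1` keeps it below both `δ` and `√t`.
  refine (allenCahnEnergy_le_of_cover hε0 hM hA hu ht.1 (γ := √t * min δ 1)
    ⟨by positivity, (mul_le_of_le_one_left hm.le hs1).trans (min_le_left _ _)⟩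
    (mul_le_of_le_one_right hs.le (min_le_right _ _))).trans (ENNReal.ofReal_le_ofReal ?_)
  have hG := energyConst_nonneg (n := n) A hM.density_pos.le
  have hexp : Real.exp (4 * t / ε ^ 2) ≤ Real.exp 4 := by
    refine Real.exp_le_exp.2 ?_
    rw [div_le_iff₀ (by positivity)]
    linarith [ht.2]
  have hratio : √t ^ (n + 1) / (√t * min δ 1) ^ n = √t / min δ 1 ^ n := by
    rw [mul_pow, pow_succ]
    field_simp
  have hlin : (ε / t + 1 / ε) * √t = ε / √t + √t / ε := by
    have hsq : √t ^ 2 = t := Real.sq_sqrt ht.1.le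
    rw [add_mul]
    congr 1
    · nth_rewrite 1 [← hsq]
      field_simp
    · ring
  rw [hratio]
  have ht0 := ht.1
  calc energyConst n A θ * Real.exp (4 * t / ε ^ 2) * (ε / t + 1 / ε) * (√t / min δ 1 ^ n)
      ≤ energyConst n A θ * Real.exp 4 * (ε / t + 1 / ε) * (√t / min δ 1 ^ n) := by gcongr
    _ = energyConst n A θ * Real.exp 4 / min δ 1 ^ n * ((ε / t + 1 / ε) * √t) := by ring
    _ = _ := by rw [hlin]

/-- The covering bound, with net scale fixed at `ε * min δ 1`, is used here only to make the energy
uniformly finite on `[ε², t]`; its size, which grows with `t`, does not enter the conclusion. -/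
theorem allenCahnEnergy_le_of_sq_le {n : ℕ} {ε : ℝ} (hε : ε ∈ Ioo (0 : ℝ) 1) {A : ℝ≥0}
    {κ δ θ : ℝ} {Ω M : Set (EuclideanSpace ℝ (Fin (n + 1)))}
    (hM : IsGeneralisedHypersurface n κ δ θ Ω M)
    (hA : μH[(n : ℝ)] M ≤ (A : ℝ≥0∞)) {u : ℝ → EuclideanSpace ℝ (Fin (n + 1)) → ℝ}
    (hu : IsAllenCahnSolution ε (phaseDatum Ω) u) {t : ℝ} (ht : ε ^ 2 ≤ t) :
    allenCahnEnergy ε (u t) ≤ allenCahnEnergy ε (u (ε ^ 2)) := by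
  have hε0 : 0 < ε := hε.1
  have hm : 0 < min δ 1 := lt_min hM.scale_pos one_pos
  refine allenCahnEnergy_antitone hε0 hu (G := energyConst n A θ * Real.exp (4 * t / ε ^ 2) *
    (ε / ε ^ 2 + 1 / ε) * (√t ^ (n + 1) / (ε * min δ 1) ^ n)) (by positivity) ht fun r hr => ?_
  have hr0 : 0 < r := (by positivity : 0 < ε ^ 2).trans_le hr.1
  have hεr : ε ≤ √r := Real.le_sqrt_of_sq_le hr.1
  refine (allenCahnEnergy_le_of_cover hε0 hM hA hu hr0 (γ := ε * min δ 1)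
    ⟨by positivity, (mul_le_of_le_one_left hm.le hε.2.le).trans (min_le_left _ _)⟩
    ((mul_le_of_le_one_right hε0.le (min_le_right _ _)).trans hεr)).trans
    (ENNReal.ofReal_le_ofReal ?_)
  have hG := energyConst_nonneg (n := n) A hM.density_pos.le
  have h1 := hr.1
  have h2 := hr.2
  gcongr

theorem mainTheorem3 (n : ℕ) (A : ℝ≥0) (δ θ : ℝ) :
    ∃ C : ℝ, 0 ≤ C ∧
      ∀ (κ : ℝ) (Ω M : Set (EuclideanSpace ℝ (Fin (n + 1)))),
        IsGeneralisedHypersurface n κ δ θ Ω M → μH[(n : ℝ)] M ≤ (A : ℝ≥0∞) →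
        ∀ ε ∈ Ioo (0 : ℝ) 1, ∀ u : ℝ → EuclideanSpace ℝ (Fin (n + 1)) → ℝ,
          IsAllenCahnSolution ε (phaseDatum Ω) u →
          (∀ t ∈ Ioo (0 : ℝ) (ε ^ 2),
            allenCahnEnergy ε (u t) ≤ ENNReal.ofReal (C * (ε / √t + √t / ε)) ∧
            allenCahnEnergy ε (u t) ≤ ENNReal.ofReal (2 * C / √t)) ∧
          (∀ t ≥ ε ^ 2, allenCahnEnergy ε (u t) ≤ ENNReal.ofReal (2 * C)) := by
  -- The constant is chosen before `δ` and `θ` are known to be positive; the absolute value secures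
  -- `C ≥ 0` in every case.
  refine ⟨|energyConst n A θ * Real.exp 4 / min δ 1 ^ n|, abs_nonneg _, ?_⟩
  intro κ Ω M hM hA ε hε u hu
  have hε0 : 0 < ε := hε.1
  -- The endpoint `ε²` is included because the monotonicity argument starts there; at that time
  -- `ε/√t + √t/ε = 2`.
  have hshort : ∀ t ∈ Ioc 0 (ε ^ 2), allenCahnEnergy ε (u t) ≤ ENNReal.ofReal
      (|energyConst n A θ * Real.exp 4 / min δ 1 ^ n| * (ε / √t + √t / ε)) := by
    intro t ht
    refine (allenCahnEnergy_short_time hε hM hA hu ht).trans (ENNReal.ofReal_le_ofReal ?_)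
    exact mul_le_mul_of_nonneg_right (le_abs_self _) (by positivity)
  set C : ℝ := |energyConst n A θ * Real.exp 4 / min δ 1 ^ n| with hC
  have hC0 : 0 ≤ C := abs_nonneg _
  refine ⟨fun t ht => ⟨hshort t ⟨ht.1, ht.2.le⟩, (hshort t ⟨ht.1, ht.2.le⟩).trans
    (ENNReal.ofReal_le_ofReal ?_)⟩, fun t ht => ?_⟩
  · have hs : 0 < √t := Real.sqrt_pos.2 ht.1
    have hsε : √t ≤ ε := (Real.sqrt_le_left hε0.le).2 ht.2.le
    have h1 : ε / √t ≤ 1 / √t := div_le_div_of_nonneg_right hε.2.le hs.le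
    have h2 : √t / ε ≤ 1 / √t := by
      refine ((div_le_one hε0).2 hsε).trans ?_
      rw [le_div_iff₀ hs]
      linarith [hε.2]
    calc C * (ε / √t + √t / ε) ≤ C * (1 / √t + 1 / √t) :=
          mul_le_mul_of_nonneg_left (add_le_add h1 h2) hC0
      _ = 2 * C / √t := by ring
  · refine (allenCahnEnergy_le_of_sq_le hε hM hA hu ht).trans
      ((hshort (ε ^ 2) ⟨by positivity, le_rfl⟩).trans (ENNReal.ofReal_le_ofReal ?_))
    rw [Real.sqrt_sq hε0.le, div_self hε0.ne']
    linarith
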